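/- Let $M_n$ be the space of complex $n\times n$ matrices with the operator norm, $\mathbf D$ the open unit disk, and $h_z(\varphi)=\frac{z+e^{i\varphi}}{z-e^{i\varphi}}$ for $z\in\mathbf D$, $\varphi\in[0,2\pi]$. Let $\mathcal H^\infty$ be the set of bounded analytic functions $A:\mathbf D\to M_n$ with $\det A\not\equiv 0$. For Lebesgue integrable $F:[a,b]\to M_n$ put $E(t)=\int_a^t F(s)\,ds$; the multiplicative integral $\overset{\curvearrowright}{\int}_a^b\exp(F(t)\,dt)$ is the limit, along partitions $a=t_0\le t_1\le\dots\le t_m=b$ directed by refinement, of the ordered products $e^{E(t_1)-E(t_0)}e^{E(t_2)-E(t_1)}\cdots e^{E(t_m)-E(t_{m-1})}$. **Theorem.** (i) Let $M_1,M_2:[0,2\pi]\to M_n$ be Lebesgue integrable and Hermitian (almost everywhere), and let $A_1,A_2\in\mathcal H^\infty$ satisfy $$A_i(z)=\overset{\curvearrowright}{\int}_0^{2\pi}\exp\bigl(h_z(\varphi)M_i(\varphi)\,d\varphi\bigr)\qquad(z\in\mathbf D,\ i=1,2).$$ If $A_1=A_2$ on $\mathbf D$, then $M_1=M_2$ almost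 everywhere on $[0,2\pi]$. (ii) Consequently, the function $M$ in the representation of an outer function is unique up to a null set: if $A\in\mathcal H^\infty$ and $$A(z)=U_i\overset{\curvearrowright}{\int}_0^{2\pi}\exp\bigl(h_z(\varphi)M_i(\varphi)\,d\varphi\bigr)\qquad(z\in\mathbf D,\ i=1,2)$$ with constant unitary matrices $U_1,U_2$ and Lebesgue integrable Hermitian $M_1,M_2:[0,2\pi]\to M_n$ whose least eigenvalues are (essentially) bounded from below, then $M_1=M_2$ almost everywhere on $[0,2\pi]$. -/

import Mathlib

open scoped Matrix.Norms.L2Operator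

noncomputable section

namespace MultInt

/-- A tagged partition `a = t 0 ≤ t 1 ≤ ⋯ ≤ t m = b` with intermediate points
`ξ i ∈ [t i, t (i+1)]`, `i < m`. Values of `t` beyond index `m`, and of `ξ` from index `m` on,
play no role. -/
structure TaggedPartition (a b : ℝ) where
  m : ℕ
  t : ℕ → ℝ
  ξ : ℕ → ℝ
  t_zero : t 0 = a
  t_last : t m = b
  t_le : ∀ i < m, t i ≤ t (i + 1)
  ξ_mem : ∀ i < m, ξ i ∈ Set.Icc (t i) (t (i + 1))

/-- The finite set of division points of a tagged partition. -/
def TaggedPartition.points {a b : ℝ} (τ : TaggedPartition a b) : Set ℝ :=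
  τ.t '' Set.Iic τ.m

/-- The left-to-right product `∏ exp (f (ξ i) (E (t (i+1)) - E (t i)))`. -/
def stieltjesProd {n : ℕ} {a b : ℝ} (f : ℝ → ℂ) (E : ℝ → Matrix (Fin n) (Fin n) ℂ)
    (τ : TaggedPartition a b) : Matrix (Fin n) (Fin n) ℂ :=
  ((List.range τ.m).map fun i =>
    NormedSpace.exp (f (τ.ξ i) • (E (τ.t (i + 1)) - E (τ.t i)))).prod

/-- `P` is the right multiplicative Stieltjes integral of `exp (f dE)` over `[a, b]`: the limit of
the products along the net of tagged partitions, directed by refinement. -/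
def HasMultStieltjesIntegral {n : ℕ} (f : ℝ → ℂ) (E : ℝ → Matrix (Fin n) (Fin n) ℂ) (a b : ℝ)
    (P : Matrix (Fin n) (Fin n) ℂ) : Prop :=
  ∀ ε > 0, ∃ τ₀ : TaggedPartition a b, ∀ τ : TaggedPartition a b,
    τ₀.points ⊆ τ.points → ‖stieltjesProd f E τ - P‖ < ε

/-- `P` is the multiplicative Lebesgue integral of `exp (A(t) dt)` over `[a, b]`: `A` is Lebesgue
integrable and `P` is the multiplicative Stieltjes integral of `exp (dE)`, `E(t) = ∫_a^t A`. -/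
def HasMultLebesgueIntegral {n : ℕ} (A : ℝ → Matrix (Fin n) (Fin n) ℂ) (a b : ℝ)
    (P : Matrix (Fin n) (Fin n) ℂ) : Prop :=
  MeasureTheory.IntegrableOn A (Set.Icc a b) ∧
    HasMultStieltjesIntegral (fun _ => 1) (fun t => ∫ s in a..t, A s) a b P

/-- The Herglotz kernel `h_z(θ) = (z + e^{iθ}) / (z - e^{iθ})`. -/
def herglotz (z : ℂ) (θ : ℝ) : ℂ :=
  (z + Complex.exp (θ * Complex.I)) / (z - Complex.exp (θ * Complex.I))

/-- Bounded analytic matrix-valued functions on the unit disk whose determinant does not vanish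
identically. -/
structure IsHInfty {n : ℕ} (A : ℂ → Matrix (Fin n) (Fin n) ℂ) : Prop where
  analytic : ∀ i j, DifferentiableOn ℂ (fun z => A z i j) (Metric.ball 0 1)
  bounded : ∃ C : ℝ, ∀ z ∈ Metric.ball (0 : ℂ) 1, ‖A z‖ ≤ C
  det_ne_zero : ∃ z ∈ Metric.ball (0 : ℂ) 1, (A z).det ≠ 0

/-- `M` is a Lebesgue integrable Hermitian matrix-valued function on `[0, 2π]`. As elements of
`L¹` are classes modulo null sets, Hermitian is meant almost everywhere. -/
structure IsIntegrableHermitian {n : ℕ} (M : ℝ → Matrix (Fin n) (Fin n) ℂ) : Prop where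
  integrable : MeasureTheory.IntegrableOn M (Set.Icc 0 (2 * Real.pi))
  hermitian : ∀ᵐ φ ∂(MeasureTheory.volume.restrict (Set.Icc 0 (2 * Real.pi))), (M φ).IsHermitian

/-- The least eigenvalue of the Hermitian function `M` on `[0, 2π]` is (essentially) bounded from
below. -/
def LeastEigenvalueBddBelow {n : ℕ} (M : ℝ → Matrix (Fin n) (Fin n) ℂ) : Prop :=
  ∃ c : ℝ, ∀ᵐ φ ∂(MeasureTheory.volume.restrict (Set.Icc 0 (2 * Real.pi))),
    ∀ (hH : (M φ).IsHermitian) (i : Fin n), c ≤ hH.eigenvalues i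

/-- `A(z) = U ∫↷_0^{2π} exp (h_z(φ) M(φ) dφ)` on the disk, as in the definition of an outer
function: `A` is in `H^∞`, `U` is unitary, and `M` is integrable and Hermitian with least
eigenvalue bounded from below. -/
structure IsOuterRepresentation {n : ℕ} (A : ℂ → Matrix (Fin n) (Fin n) ℂ)
    (U : Matrix (Fin n) (Fin n) ℂ) (M : ℝ → Matrix (Fin n) (Fin n) ℂ) : Prop where
  hInfty : IsHInfty A
  unitary : U ∈ Matrix.unitaryGroup (Fin n) ℂ
  integrableHermitian : IsIntegrableHermitian M
  bddBelow : LeastEigenvalueBddBelow M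
  eq_integral : ∀ z ∈ Metric.ball (0 : ℂ) 1, ∃ P : Matrix (Fin n) (Fin n) ℂ,
    HasMultLebesgueIntegral (fun φ => herglotz z φ • M φ) 0 (2 * Real.pi) P ∧ A z = U * P

end MultInt

end

section

open MeasureTheory Set Filter Topology
open scoped Interval

namespace MultInt

section Partition

/-- Sums of squared increments of a continuous monotone function are small on fine partitions. -/
theorem exists_mesh_sum_sq_le {c : ℝ → ℝ} (hc : Continuous c) (hm : Monotone c) (a b : ℝ)
    {ε : ℝ} (hε : 0 < ε) :
    ∃ η > 0, ∀ (m : ℕ) (t : ℕ → ℝ), t 0 = a → t m = b →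
      (∀ i < m, t i ≤ t (i + 1)) → (∀ i < m, t (i + 1) - t i ≤ η) →
      ∑ i ∈ Finset.range m, (c (t (i + 1)) - c (t i)) ^ 2 ≤ ε := by
  have huc : UniformContinuousOn c (Icc a b) :=
    isCompact_Icc.uniformContinuousOn_of_continuous hc.continuousOn
  set K : ℝ := |c b - c a| + 1 with hK
  have hKpos : 0 < K := by positivity
  obtain ⟨η, hη, h⟩ := Metric.uniformContinuousOn_iff_le.1 huc (ε / K) (by positivity)
  refine ⟨η, hη, fun m t h0 hmb hle hmesh => ?_⟩
  have hmono : ∀ i ≤ m, ∀ j ≤ i, t j ≤ t i := by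
    intro i
    induction i with
    | zero => intro _ j hj; simp at hj; simp [hj]
    | succ i ih =>
      intro hi j hj
      rcases Nat.lt_or_ge j (i + 1) with hj' | hj'
      · exact (ih (by omega) j (by omega)).trans (hle i (by omega))
      · rw [le_antisymm hj hj']
  have hmem : ∀ i ≤ m, t i ∈ Icc a b := fun i hi =>
    ⟨h0 ▸ hmono i hi 0 (Nat.zero_le _), hmb ▸ hmono m le_rfl i hi⟩
  calc ∑ i ∈ Finset.range m, (c (t (i + 1)) - c (t i)) ^ 2
      ≤ ∑ i ∈ Finset.range m, ε / K * (c (t (i + 1)) - c (t i)) := by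
        refine Finset.sum_le_sum fun i hi => ?_
        have hi : i < m := Finset.mem_range.1 hi
        have h1 : 0 ≤ c (t (i + 1)) - c (t i) := sub_nonneg.2 (hm (hle i hi))
        have h2 : c (t (i + 1)) - c (t i) ≤ ε / K := by
          refine (le_abs_self _).trans ?_
          have := h (t (i + 1)) (hmem _ hi) (t i) (hmem _ hi.le) (by
            rw [Real.dist_eq, abs_of_nonneg (sub_nonneg.2 (hle i hi))]; exact hmesh i hi)
          rwa [Real.dist_eq] at this
        rw [sq]
        exact mul_le_mul_of_nonneg_right h2 h1
    _ = ε / K * (c b - c a) := by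
        rw [← Finset.mul_sum, Finset.sum_range_sub (fun i => c (t i)), h0, hmb]
    _ ≤ ε / K * K := by
        gcongr
        rw [hK]; linarith [le_abs_self (c b - c a)]
    _ = ε := by field_simp

/-- The division points of `[a, b]` into `N` equal parts. -/
noncomputable def uniformPoint (a b : ℝ) (N i : ℕ) : ℝ := a + (b - a) * (i / N)

theorem uniformPoint_zero (a b : ℝ) (N : ℕ) : uniformPoint a b N 0 = a := by
  simp [uniformPoint]

theorem uniformPoint_last (a b : ℝ) {N : ℕ} (hN : N ≠ 0) : uniformPoint a b N N = b := by
  have : (N : ℝ) ≠ 0 := by exact_mod_cast hN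
  simp [uniformPoint, this]

theorem uniformPoint_succ_sub (a b : ℝ) (N i : ℕ) :
    uniformPoint a b N (i + 1) - uniformPoint a b N i = (b - a) / N := by
  simp only [uniformPoint]; push_cast; ring

theorem uniformPoint_le_succ {a b : ℝ} (hab : a ≤ b) (N i : ℕ) :
    uniformPoint a b N i ≤ uniformPoint a b N (i + 1) := by
  rw [← sub_nonneg, uniformPoint_succ_sub]
  exact div_nonneg (sub_nonneg.2 hab) (Nat.cast_nonneg _)

theorem le_uniformPoint {a b : ℝ} (hab : a ≤ b) (N i : ℕ) : a ≤ uniformPoint a b N i := by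
  rw [uniformPoint]
  have := mul_nonneg (sub_nonneg.2 hab) (by positivity : (0 : ℝ) ≤ i / N)
  linarith

theorem tendsto_sum_sq_uniformPoint {c : ℝ → ℝ} (hc : Continuous c) (hm : Monotone c) {a b : ℝ}
    (hab : a ≤ b) :
    Tendsto (fun N : ℕ => ∑ i ∈ Finset.range N,
      (c (uniformPoint a b N (i + 1)) - c (uniformPoint a b N i)) ^ 2) atTop (𝓝 0) := by
  rw [Metric.tendsto_atTop]
  intro ε hε
  obtain ⟨η, hη, h⟩ := exists_mesh_sum_sq_le hc hm a b (half_pos hε)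
  have h1 : ∀ᶠ N : ℕ in atTop, (b - a) / N ≤ η :=
    (tendsto_const_div_atTop_nhds_zero_nat (b - a)).eventually_le_const hη
  obtain ⟨N₀, hN₀⟩ := eventually_atTop.1 (h1.and (eventually_ge_atTop 1))
  refine ⟨N₀, fun N hN => ?_⟩
  obtain ⟨h2, h3⟩ := hN₀ N hN
  have := h N (uniformPoint a b N) (uniformPoint_zero a b N) (uniformPoint_last a b (by omega))
    (fun i _ => uniformPoint_le_succ hab N i)
    (fun i _ => by rw [uniformPoint_succ_sub]; exact h2)
  rw [Real.dist_eq, sub_zero, abs_of_nonneg (Finset.sum_nonneg fun _ _ => sq_nonneg _)]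
  linarith

/-- A function whose increments are dominated by squared increments of a continuous monotone
function is constant. -/
theorem eq_of_norm_sub_le_sq {E : Type*} [NormedAddCommGroup E] {D : ℝ → E} {c : ℝ → ℝ}
    (hc : Continuous c) (hm : Monotone c) {K a b : ℝ} (hab : a ≤ b)
    (h : ∀ s t, a ≤ s → s ≤ t → ‖D t - D s‖ ≤ K * (c t - c s) ^ 2) : D b = D a := by
  have h1 := (tendsto_sum_sq_uniformPoint hc hm hab).const_mul K
  rw [mul_zero] at h1
  have h2 : ∀ᶠ N : ℕ in atTop, ‖D b - D a‖ ≤ K * ∑ i ∈ Finset.range N,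
      (c (uniformPoint a b N (i + 1)) - c (uniformPoint a b N i)) ^ 2 := by
    filter_upwards [eventually_ge_atTop 1] with N hN
    have h3 : D b - D a = ∑ i ∈ Finset.range N,
        (D (uniformPoint a b N (i + 1)) - D (uniformPoint a b N i)) := by
      rw [Finset.sum_range_sub (fun i => D (uniformPoint a b N i)), uniformPoint_zero,
        uniformPoint_last a b (by omega)]
    rw [h3, Finset.mul_sum]
    exact (norm_sum_le _ _).trans (Finset.sum_le_sum fun i _ =>
      h _ _ (le_uniformPoint hab N i) (uniformPoint_le_succ hab N i))
  exact sub_eq_zero.1 (norm_le_zero_iff.1 (ge_of_tendsto h1 h2))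

end Partition

section Primitive

theorem continuous_primitive {E : Type*} [NormedAddCommGroup E] [NormedSpace ℝ E]
    {f : ℝ → E} (hf : Integrable f) : Continuous fun t => ∫ s in (0 : ℝ)..t, f s :=
  intervalIntegral.continuous_primitive (fun _ _ => hf.intervalIntegrable) 0

theorem monotone_primitive {w : ℝ → ℝ} (hw : Integrable w) (h0 : ∀ s, 0 ≤ w s) :
    Monotone fun t => ∫ s in (0 : ℝ)..t, w s := by
  intro s t hst
  have := intervalIntegral.integral_add_adjacent_intervals
    (hw.intervalIntegrable (a := 0) (b := s)) (hw.intervalIntegrable (a := s) (b := t))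
  have h2 : 0 ≤ ∫ x in s..t, w x := intervalIntegral.integral_nonneg hst fun x _ => h0 x
  simp only
  linarith

theorem primitive_sub {E : Type*} [NormedAddCommGroup E] [NormedSpace ℝ E]
    {f : ℝ → E} (hf : Integrable f) (s t : ℝ) :
    (∫ x in (0 : ℝ)..t, f x) - ∫ x in (0 : ℝ)..s, f x = ∫ x in s..t, f x :=
  intervalIntegral.integral_interval_sub_left hf.intervalIntegrable hf.intervalIntegrable

theorem norm_integral_le_primitive_sub {E : Type*} [NormedAddCommGroup E] [NormedSpace ℝ E]
    {f : ℝ → E} {w : ℝ → ℝ} (hw : Integrable w)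
    (h : ∀ s, ‖f s‖ ≤ w s) {s t : ℝ} (hst : s ≤ t) :
    ‖∫ x in s..t, f x‖ ≤ (∫ x in (0 : ℝ)..t, w x) - ∫ x in (0 : ℝ)..s, w x := by
  rw [primitive_sub hw]
  exact intervalIntegral.norm_integral_le_of_norm_le hst (Eventually.of_forall fun x _ => h x)
    hw.intervalIntegrable

variable {𝔸 : Type*} [NormedRing 𝔸]

theorem intervalIntegrable_mul_continuous {f Y : ℝ → 𝔸} (hf : Integrable f) (hY : Continuous Y)
    (s t : ℝ) : IntervalIntegrable (fun x => f x * Y x) volume s t :=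
  hf.intervalIntegrable.mul_continuousOn hY.continuousOn

theorem intervalIntegrable_continuous_mul {f Y : ℝ → 𝔸} (hf : Integrable f) (hY : Continuous Y)
    (s t : ℝ) : IntervalIntegrable (fun x => Y x * f x) volume s t :=
  hf.intervalIntegrable.continuousOn_mul hY.continuousOn

variable [NormedAlgebra ℝ 𝔸] [CompleteSpace 𝔸]

theorem intervalIntegral_mul_const {f : ℝ → 𝔸} (hf : Integrable f) (s t : ℝ) (a : 𝔸) :
    ∫ x in s..t, f x * a = (∫ x in s..t, f x) * a :=
  ((ContinuousLinearMap.mul ℝ 𝔸).flip a).intervalIntegral_comp_comm hf.intervalIntegrable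

theorem intervalIntegral_const_mul {f : ℝ → 𝔸} (hf : Integrable f) (s t : ℝ) (a : 𝔸) :
    ∫ x in s..t, a * f x = a * ∫ x in s..t, f x :=
  ((ContinuousLinearMap.mul ℝ 𝔸) a).intervalIntegral_comp_comm hf.intervalIntegrable

/-- Product rule for two indefinite integrals. -/
theorem mul_eq_add_integral {f g X Y : ℝ → 𝔸} (hf : Integrable f) (hg : Integrable g)
    (hX : Continuous X) (hY : Continuous Y) {x₀ y₀ : 𝔸}
    (hX' : ∀ t, 0 ≤ t → X t = x₀ + ∫ s in (0 : ℝ)..t, g s)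
    (hY' : ∀ t, 0 ≤ t → Y t = y₀ + ∫ s in (0 : ℝ)..t, f s) {t : ℝ} (ht : 0 ≤ t) :
    X t * Y t = x₀ * y₀ + ∫ s in (0 : ℝ)..t, (g s * Y s + X s * f s) := by
  set w : ℝ → ℝ := fun s => ‖f s‖ + ‖g s‖ with hw
  have hwi : Integrable w := hf.norm.add hg.norm
  have hw0 : ∀ s, 0 ≤ w s := fun s => by positivity
  set c : ℝ → ℝ := fun t => ∫ s in (0 : ℝ)..t, w s with hcdef
  have hcm : Monotone c := monotone_primitive hwi hw0
  have hi : ∀ a b, IntervalIntegrable (fun s => g s * Y s + X s * f s) volume a b := fun a b =>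
    (intervalIntegrable_mul_continuous hg hY a b).add (intervalIntegrable_continuous_mul hf hX a b)
  have hdX : ∀ s t, 0 ≤ s → s ≤ t → X t - X s = ∫ x in s..t, g x := fun s t hs hst => by
    rw [hX' t (hs.trans hst), hX' s hs, add_sub_add_left_eq_sub, primitive_sub hg]
  have hdY : ∀ s t, 0 ≤ s → s ≤ t → Y t - Y s = ∫ x in s..t, f x := fun s t hs hst => by
    rw [hY' t (hs.trans hst), hY' s hs, add_sub_add_left_eq_sub, primitive_sub hf]
  have hnX : ∀ s t, 0 ≤ s → s ≤ t → ‖X t - X s‖ ≤ c t - c s := fun s t hs hst => by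
    rw [hdX s t hs hst]
    exact norm_integral_le_primitive_sub hwi (fun x => by simp [hw]) hst
  have hnY : ∀ s t, 0 ≤ s → s ≤ t → ‖Y t - Y s‖ ≤ c t - c s := fun s t hs hst => by
    rw [hdY s t hs hst]
    exact norm_integral_le_primitive_sub hwi (fun x => by simp [hw]) hst
  have key := eq_of_norm_sub_le_sq (D := fun t => X t * Y t -
    ∫ s in (0 : ℝ)..t, (g s * Y s + X s * f s)) (continuous_primitive hwi) hcm (K := 2) ht ?_
  · have hX0 := hX' 0 le_rfl
    have hY0 := hY' 0 le_rfl
    simp only [intervalIntegral.integral_same, add_zero, sub_zero] at hX0 hY0 key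
    rw [hX0, hY0] at key
    rw [← key]; abel
  intro s t hs hst
  have hnonneg : 0 ≤ c t - c s := sub_nonneg.2 (hcm hst)
  have e1 : ∫ x in s..t, g x * (Y x - Y s) = (∫ x in s..t, g x * Y x) - (X t - X s) * Y s := by
    rw [hdX s t hs hst, ← intervalIntegral_mul_const hg, ← intervalIntegral.integral_sub
      (intervalIntegrable_mul_continuous hg hY s t)
      (intervalIntegrable_mul_continuous hg continuous_const s t)]
    simp_rw [mul_sub]
  have e2 : ∫ x in s..t, (X x - X t) * f x = (∫ x in s..t, X x * f x) - X t * (Y t - Y s) := by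
    rw [hdY s t hs hst, ← intervalIntegral_const_mul hf, ← intervalIntegral.integral_sub
      (intervalIntegrable_continuous_mul hf hX s t)
      (intervalIntegrable_continuous_mul hf continuous_const s t)]
    simp_rw [sub_mul]
  have e3 : (X t * Y t - ∫ x in (0 : ℝ)..t, (g x * Y x + X x * f x)) -
      (X s * Y s - ∫ x in (0 : ℝ)..s, (g x * Y x + X x * f x)) =
      -∫ x in s..t, (g x * (Y x - Y s) + (X x - X t) * f x) := by
    have h1 : (∫ x in (0 : ℝ)..t, (g x * Y x + X x * f x)) -
        ∫ x in (0 : ℝ)..s, (g x * Y x + X x * f x) = ∫ x in s..t, (g x * Y x + X x * f x) :=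
      intervalIntegral.integral_interval_sub_left (hi _ _) (hi _ _)
    rw [intervalIntegral.integral_add
      (intervalIntegrable_mul_continuous hg (Y := fun x => Y x - Y s) (by fun_prop) s t)
      (intervalIntegrable_continuous_mul hf (Y := fun x => X x - X t) (by fun_prop) s t), e1, e2,
      sub_sub_sub_comm, h1, intervalIntegral.integral_add
      (intervalIntegrable_mul_continuous hg hY s t) (intervalIntegrable_continuous_mul hf hX s t)]
    noncomm_ring
  rw [e3, norm_neg]
  calc ‖∫ x in s..t, (g x * (Y x - Y s) + (X x - X t) * f x)‖
      ≤ ∫ x in s..t, (c t - c s) * w x := by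
        refine intervalIntegral.norm_integral_le_of_norm_le hst (Eventually.of_forall ?_)
          (hwi.intervalIntegrable.const_mul _)
        intro x hx
        have hY1 : ‖Y x - Y s‖ ≤ c t - c s :=
          (hnY s x hs hx.1.le).trans (by linarith [hcm hx.2])
        have hX1 : ‖X x - X t‖ ≤ c t - c s := by
          rw [norm_sub_rev]
          exact (hnX x t (hs.trans hx.1.le) hx.2).trans (by linarith [hcm hx.1.le])
        calc _ ≤ ‖g x‖ * ‖Y x - Y s‖ + ‖X x - X t‖ * ‖f x‖ :=
              (norm_add_le _ _).trans (add_le_add (norm_mul_le _ _) (norm_mul_le _ _))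
          _ ≤ ‖g x‖ * (c t - c s) + (c t - c s) * ‖f x‖ := by gcongr
          _ = (c t - c s) * w x := by simp only [hw]; ring
    _ = (c t - c s) ^ 2 := by
        rw [intervalIntegral.integral_const_mul, ← primitive_sub hwi, sq]
    _ ≤ 2 * (c t - c s) ^ 2 := by nlinarith [sq_nonneg (c t - c s)]

end Primitive

section Volterra

theorem norm_intervalIntegral_le_integral_norm {E : Type*} [NormedAddCommGroup E] [NormedSpace ℝ E]
    {f : ℝ → E} (hf : Integrable f) (s t : ℝ) : ‖∫ x in s..t, f x‖ ≤ ∫ x, ‖f x‖ :=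
  intervalIntegral.norm_integral_le_integral_norm_uIoc.trans
    (setIntegral_le_integral hf.norm (Eventually.of_forall fun _ => norm_nonneg _))

theorem integral_mul_primitive_pow {w : ℝ → ℝ} (hw : Integrable w) (k : ℕ) {t : ℝ} (ht : 0 ≤ t) :
    ∫ s in (0 : ℝ)..t, w s * (∫ x in (0 : ℝ)..s, w x) ^ k =
      (∫ x in (0 : ℝ)..t, w x) ^ (k + 1) / (k + 1) := by
  set c : ℝ → ℝ := fun t => ∫ s in (0 : ℝ)..t, w s with hc
  have hcc : Continuous c := continuous_primitive hw
  have hint : ∀ k : ℕ, Integrable fun s => (k + 1 : ℝ) * (w s * c s ^ k) := fun k => by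
    refine (hw.mul_bdd (c := (∫ x, ‖w x‖) ^ k) (hcc.pow k).aestronglyMeasurable
      (Eventually.of_forall fun s => ?_)).const_mul _
    rw [Pi.pow_apply, norm_pow]
    exact pow_le_pow_left₀ (norm_nonneg _) (norm_intervalIntegral_le_integral_norm hw 0 s) k
  have key : ∀ k : ℕ, ∀ t, 0 ≤ t →
      c t ^ (k + 1) = ∫ s in (0 : ℝ)..t, (k + 1) * (w s * c s ^ k) := by
    intro k
    induction k with
    | zero => intro t _; simp [hc]
    | succ k ih =>
      intro t ht
      rw [pow_succ, mul_eq_add_integral hw (hint k) (X := fun t => c t ^ (k + 1)) (hcc.pow _) hcc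
        (x₀ := 0) (y₀ := 0)
        (fun t ht => by rw [zero_add]; exact ih t ht) (fun t _ => by rw [zero_add]) ht,
        zero_mul, zero_add]
      refine intervalIntegral.integral_congr fun s _ => ?_
      push_cast
      ring
  rw [eq_div_iff (by positivity), mul_comm, ← intervalIntegral.integral_const_mul]
  exact (key k t ht).symm

variable {E : Type*} [NormedAddCommGroup E] [NormedSpace ℝ E]

/-- Terms of the Picard series of the Volterra equation `Y t = y₀ + ∫₀ᵗ L s (Y s) ds`. -/
noncomputable def picardTerm (L : ℝ → E →L[ℝ] E) (y₀ : E) : ℕ → ℝ → E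
  | 0 => fun _ => y₀
  | k + 1 => fun t => ∫ s in (0 : ℝ)..t, L s (picardTerm L y₀ k s)

variable {L : ℝ → E →L[ℝ] E}

theorem intervalIntegrable_clm_apply (hL : Integrable L) {Y : ℝ → E} (hY : Continuous Y)
    (s t : ℝ) : IntervalIntegrable (fun x => L x (Y x)) volume s t := by
  obtain ⟨K, hK⟩ := isCompact_uIcc.exists_bound_of_continuousOn (s := uIcc s t) hY.continuousOn
  have hmeas : AEStronglyMeasurable (fun x => L x (Y x)) (volume.restrict (Ι s t)) :=
    ContinuousLinearMap.aestronglyMeasurable_comp₂ (ContinuousLinearMap.id ℝ (E →L[ℝ] E))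
      hL.aestronglyMeasurable.restrict hY.aestronglyMeasurable
  refine IntervalIntegrable.mono_fun (g := fun x => L x (Y x)) (f := fun x => ‖L x‖ * K)
    ((hL.norm.mul_const K).intervalIntegrable) hmeas ?_
  refine (ae_restrict_iff' measurableSet_uIoc).2 (Eventually.of_forall fun x hx => ?_)
  refine ((L x).le_opNorm _).trans ((mul_le_mul_of_nonneg_left
    (hK x (uIoc_subset_uIcc hx)) (norm_nonneg _)).trans (le_abs_self _))

theorem continuous_picardTerm (hL : Integrable L) (y₀ : E) (k : ℕ) :
    Continuous (picardTerm L y₀ k) := by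
  induction k with
  | zero => exact continuous_const
  | succ k ih =>
    exact intervalIntegral.continuous_primitive (intervalIntegrable_clm_apply hL ih) 0

theorem norm_picardTerm_le (hL : Integrable L) (y₀ : E) (k : ℕ) {t : ℝ} (ht : 0 ≤ t) :
    ‖picardTerm L y₀ k t‖ ≤ ‖y₀‖ * (∫ s in (0 : ℝ)..t, ‖L s‖) ^ k / k.factorial := by
  induction k generalizing t with
  | zero => simp [picardTerm]
  | succ k ih =>
    have h0 : ∀ s ∈ Ioc 0 t, ‖L s (picardTerm L y₀ k s)‖ ≤
        ‖y₀‖ / k.factorial * (‖L s‖ * (∫ x in (0 : ℝ)..s, ‖L x‖) ^ k) := fun s hs => by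
      refine ((L s).le_opNorm _).trans ?_
      refine (mul_le_mul_of_nonneg_left (ih hs.1.le) (norm_nonneg _)).trans (le_of_eq ?_)
      ring
    refine (intervalIntegral.norm_integral_le_of_norm_le ht (Eventually.of_forall h0) ?_).trans
      (le_of_eq ?_)
    · exact (intervalIntegrable_mul_continuous hL.norm
        ((continuous_primitive hL.norm).pow k) 0 t).const_mul _
    · rw [intervalIntegral.integral_const_mul, integral_mul_primitive_pow hL.norm k ht,
        Nat.factorial_succ]
      push_cast
      field_simp

/-- Linear Volterra equations with integrable coefficients are solvable. -/
theorem exists_volterra_solution [CompleteSpace E] (hL : Integrable L) (y₀ : E) :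
    ∃ Y : ℝ → E, Continuous Y ∧ (∀ t, ‖Y t‖ ≤ ‖y₀‖ * Real.exp (∫ s, ‖L s‖)) ∧
      ∀ t, 0 ≤ t → Y t = y₀ + ∫ s in (0 : ℝ)..t, L s (Y s) := by
  set C : ℝ := ∫ s, ‖L s‖ with hC
  set b : ℕ → ℝ := fun k => ‖y₀‖ * (C ^ k / k.factorial) with hb
  have hbs : Summable b := (Real.summable_pow_div_factorial C).mul_left _
  have hbound : ∀ k t, 0 ≤ t → ‖picardTerm L y₀ k t‖ ≤ b k := fun k t ht => by
    refine (norm_picardTerm_le hL y₀ k ht).trans ?_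
    simp only [hb]
    rw [mul_div_assoc]
    have h1 : ∫ s in (0 : ℝ)..t, ‖L s‖ ≤ C :=
      (le_abs_self _).trans ((norm_intervalIntegral_le_integral_norm hL.norm 0 t).trans
        (le_of_eq (by simp [hC])))
    have h2 : 0 ≤ ∫ s in (0 : ℝ)..t, ‖L s‖ :=
      intervalIntegral.integral_nonneg ht fun _ _ => norm_nonneg _
    gcongr
  have hsum : ∀ t, 0 ≤ t → Summable fun k => picardTerm L y₀ k t := fun t ht =>
    Summable.of_norm_bounded hbs (hbound · t ht)
  refine ⟨fun t => ∑' k, picardTerm L y₀ k (max t 0), ?_, fun t => ?_, fun t ht => ?_⟩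
  · exact continuous_tsum (fun k => (continuous_picardTerm hL y₀ k).comp
      (continuous_id.max continuous_const)) hbs (fun k t => hbound k _ (le_max_right _ _))
  · have hb' : HasSum b (‖y₀‖ * Real.exp C) := by
      rw [Real.exp_eq_exp_ℝ]
      exact (NormedSpace.expSeries_div_hasSum_exp C).mul_left _
    exact tsum_of_norm_bounded hb' fun k => hbound k _ (le_max_right _ _)
  · have hI : HasSum (fun k => ∫ s in (0 : ℝ)..t, L s (picardTerm L y₀ k s))
        (∫ s in (0 : ℝ)..t, L s (∑' k, picardTerm L y₀ k (max s 0))) := by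
      refine intervalIntegral.hasSum_integral_of_dominated_convergence
        (fun k s => ‖L s‖ * b k) (fun k => ?_) (fun k => ?_) ?_ ?_ ?_
      · exact (intervalIntegrable_clm_apply hL (continuous_picardTerm hL y₀ k)
          0 t).aestronglyMeasurable_restrict_uIoc
      · refine Eventually.of_forall fun s hs => ?_
        rw [uIoc_of_le ht] at hs
        exact ((L s).le_opNorm _).trans
          (mul_le_mul_of_nonneg_left (hbound k s hs.1.le) (norm_nonneg _))
      · exact Eventually.of_forall fun s _ => hbs.mul_left _
      · simp_rw [tsum_mul_left]
        exact (hL.norm.mul_const _).intervalIntegrable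
      · refine Eventually.of_forall fun s hs => ?_
        rw [uIoc_of_le ht] at hs
        rw [max_eq_left hs.1.le]
        exact (hsum s hs.1.le).hasSum.mapL (L s)
    simp only
    rw [← hI.tsum_eq, max_eq_left ht, (hsum t ht).tsum_eq_zero_add]
    rfl

end Volterra

section Exponential

variable {𝔸 : Type*} [NormedRing 𝔸] [NormedAlgebra ℂ 𝔸] [NormOneClass 𝔸]

theorem norm_exp_le (x : 𝔸) : ‖NormedSpace.exp x‖ ≤ Real.exp ‖x‖ := by
  rw [NormedSpace.exp_eq_tsum ℂ, Real.exp_eq_exp_ℝ]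
  refine tsum_of_norm_bounded (NormedSpace.expSeries_div_hasSum_exp ‖x‖) fun k => ?_
  rw [norm_smul, norm_inv, Complex.norm_natCast, div_eq_inv_mul]
  exact mul_le_mul_of_nonneg_left (norm_pow_le x k) (by positivity)

theorem norm_exp_sub_one_sub_le [CompleteSpace 𝔸] (x : 𝔸) :
    ‖NormedSpace.exp x - 1 - x‖ ≤ ‖x‖ ^ 2 * Real.exp ‖x‖ := by
  have h := NormedSpace.exp_series_hasSum_exp' (𝕂 := ℂ) x
  have h2 := (hasSum_nat_add_iff' 2).2 h
  have h3 : HasSum (fun k : ℕ => ‖x‖ ^ 2 * (‖x‖ ^ k / k.factorial)) (‖x‖ ^ 2 * Real.exp ‖x‖) := by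
    rw [Real.exp_eq_exp_ℝ]
    exact (NormedSpace.expSeries_div_hasSum_exp ‖x‖).mul_left _
  have h4 : NormedSpace.exp x - 1 - x =
      NormedSpace.exp x - ∑ i ∈ Finset.range 2, ((i.factorial : ℂ)⁻¹) • x ^ i := by
    simp [Finset.sum_range_succ, sub_sub]
  rw [h4, ← h2.tsum_eq]
  refine tsum_of_norm_bounded h3 fun k => ?_
  rw [norm_smul, norm_inv, Complex.norm_natCast]
  calc ((k + 2).factorial : ℝ)⁻¹ * ‖x ^ (k + 2)‖ ≤ (k.factorial : ℝ)⁻¹ * ‖x‖ ^ (k + 2) := by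
        gcongr
        · omega
        · exact norm_pow_le x _
    _ = ‖x‖ ^ 2 * (‖x‖ ^ k / k.factorial) := by ring

end Exponential

section Evolution

variable {𝔸 : Type*} [NormedRing 𝔸]

theorem integrable_continuous_mul {F Y : ℝ → 𝔸} (hF : Integrable F) (hY : Continuous Y)
    {K : ℝ} (hK : ∀ t, ‖Y t‖ ≤ K) : Integrable fun s => Y s * F s := by
  refine Integrable.mono' (hF.norm.const_mul K)
    (hY.aestronglyMeasurable.mul hF.aestronglyMeasurable) (Eventually.of_forall fun s => ?_)
  exact (norm_mul_le _ _).trans (mul_le_mul_of_nonneg_right (hK s) (norm_nonneg _))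

theorem integrable_mul_continuous {F Y : ℝ → 𝔸} (hF : Integrable F) (hY : Continuous Y)
    {K : ℝ} (hK : ∀ t, ‖Y t‖ ≤ K) : Integrable fun s => F s * Y s := by
  refine Integrable.mono' (hF.norm.mul_const K)
    (hF.aestronglyMeasurable.mul hY.aestronglyMeasurable) (Eventually.of_forall fun s => ?_)
  exact (norm_mul_le _ _).trans (mul_le_mul_of_nonneg_left (hK s) (norm_nonneg _))

variable [NormedAlgebra ℂ 𝔸]

/-- `Y` solves `Y' = Y F`, `Y 0 = 1` and `Z` solves `Z' = -F Z`, `Z 0 = 1` on `[0, ∞)`, in the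
integrated sense; `Z` is inverse to `Y`. -/
structure IsEvolution (F Y Z : ℝ → 𝔸) : Prop where
  integrable : Integrable F
  continuous_left : Continuous Y
  continuous_right : Continuous Z
  norm_left_le : ∀ t, ‖Y t‖ ≤ Real.exp (∫ s, ‖F s‖)
  norm_right_le : ∀ t, ‖Z t‖ ≤ Real.exp (∫ s, ‖F s‖)
  left_eq : ∀ t, 0 ≤ t → Y t = 1 + ∫ s in (0 : ℝ)..t, Y s * F s
  right_eq : ∀ t, 0 ≤ t → Z t = 1 + ∫ s in (0 : ℝ)..t, -(F s * Z s)
  left_mul_right : ∀ t, 0 ≤ t → Y t * Z t = 1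
  right_mul_left : ∀ t, 0 ≤ t → Z t * Y t = 1

theorem exists_isEvolution [CompleteSpace 𝔸] [NormOneClass 𝔸] [IsDedekindFiniteMonoid 𝔸]
    {F : ℝ → 𝔸} (hF : Integrable F) : ∃ Y Z, IsEvolution F Y Z := by
  have hR : ∀ a : 𝔸, ‖(ContinuousLinearMap.mul ℝ 𝔸).flip a‖ ≤ ‖a‖ := fun a =>
    ContinuousLinearMap.opNorm_le_bound _ (norm_nonneg _) fun x => by
      simpa [mul_comm] using norm_mul_le x a
  have hLe : ∀ a : 𝔸, ‖-(ContinuousLinearMap.mul ℝ 𝔸) a‖ ≤ ‖a‖ := fun a => by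
    rw [norm_neg]
    exact ContinuousLinearMap.opNorm_le_bound _ (norm_nonneg _) fun x => norm_mul_le a x
  have hiR : Integrable fun s => (ContinuousLinearMap.mul ℝ 𝔸).flip (F s) :=
    (ContinuousLinearMap.mul ℝ 𝔸).flip.integrable_comp hF
  have hiL : Integrable fun s => -(ContinuousLinearMap.mul ℝ 𝔸) (F s) :=
    ((ContinuousLinearMap.mul ℝ 𝔸).integrable_comp hF).neg
  obtain ⟨Y, hYc, hYn, hY⟩ := exists_volterra_solution hiR 1
  obtain ⟨Z, hZc, hZn, hZ⟩ := exists_volterra_solution hiL 1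
  have hYn' : ∀ t, ‖Y t‖ ≤ Real.exp (∫ s, ‖F s‖) := fun t => (hYn t).trans (by
    rw [norm_one, one_mul]
    exact Real.exp_le_exp.2 (integral_mono hiR.norm hF.norm fun s => hR _))
  have hZn' : ∀ t, ‖Z t‖ ≤ Real.exp (∫ s, ‖F s‖) := fun t => (hZn t).trans (by
    rw [norm_one, one_mul]
    exact Real.exp_le_exp.2 (integral_mono hiL.norm hF.norm fun s => hLe _))
  have hY' : ∀ t, 0 ≤ t → Y t = 1 + ∫ s in (0 : ℝ)..t, Y s * F s := fun t ht => hY t ht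
  have hZ' : ∀ t, 0 ≤ t → Z t = 1 + ∫ s in (0 : ℝ)..t, -(F s * Z s) := fun t ht => hZ t ht
  have hYZ : ∀ t, 0 ≤ t → Y t * Z t = 1 := fun t ht => by
    rw [mul_eq_add_integral (integrable_mul_continuous hF hZc hZn').neg
      (integrable_continuous_mul hF hYc hYn') hYc hZc hY' hZ' ht, mul_one]
    simp [mul_assoc]
  exact ⟨Y, Z, hF, hYc, hZc, hYn', hZn', hY', hZ', hYZ, fun t ht => mul_eq_one_symm (hYZ t ht)⟩

end Evolution

section LocalEstimates

theorem integral_norm_mono {E : Type*} [NormedAddCommGroup E] {f : ℝ → E} (hf : Integrable f)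
    {s x t : ℝ} (hx : x ∈ Ioc s t) : ∫ y in s..x, ‖f y‖ ≤ ∫ y in s..t, ‖f y‖ := by
  rw [← primitive_sub hf.norm s x, ← primitive_sub hf.norm s t]
  exact sub_le_sub_right (monotone_primitive hf.norm (fun _ => norm_nonneg _) hx.2) _

variable {𝔸 : Type*} [NormedRing 𝔸]

/-- Ordered product of the exponentials of the increments of `E` over the points `t 0, …, t m`. -/
noncomputable def expProd (E : ℝ → 𝔸) (t : ℕ → ℝ) (m : ℕ) : 𝔸 :=
  ((List.range m).map fun i => NormedSpace.exp (E (t (i + 1)) - E (t i))).prod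

theorem expProd_succ (E : ℝ → 𝔸) (t : ℕ → ℝ) (m : ℕ) :
    expProd E t (m + 1) = expProd E t m * NormedSpace.exp (E (t (m + 1)) - E (t m)) := by
  simp [expProd, List.range_succ]

variable [NormedAlgebra ℂ 𝔸] {F Y Z : ℝ → 𝔸}

namespace IsEvolution

theorem left_sub (h : IsEvolution F Y Z) {s t : ℝ} (hs : 0 ≤ s) (hst : s ≤ t) :
    Y t - Y s = ∫ x in s..t, Y x * F x := by
  rw [h.left_eq t (hs.trans hst), h.left_eq s hs, add_sub_add_left_eq_sub,
    primitive_sub (integrable_continuous_mul h.integrable h.continuous_left h.norm_left_le)]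

theorem right_sub (h : IsEvolution F Y Z) {s t : ℝ} (hs : 0 ≤ s) (hst : s ≤ t) :
    Z t - Z s = -∫ x in s..t, F x * Z x := by
  rw [h.right_eq t (hs.trans hst), h.right_eq s hs, add_sub_add_left_eq_sub,
    intervalIntegral.integral_neg, intervalIntegral.integral_neg, neg_sub_neg, ← neg_sub,
    primitive_sub (integrable_mul_continuous h.integrable h.continuous_right h.norm_right_le)]

theorem norm_left_sub_le (h : IsEvolution F Y Z) {s t : ℝ} (hs : 0 ≤ s) (hst : s ≤ t) :
    ‖Y t - Y s‖ ≤ Real.exp (∫ x, ‖F x‖) * ∫ x in s..t, ‖F x‖ := by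
  rw [h.left_sub hs hst, ← intervalIntegral.integral_const_mul]
  refine intervalIntegral.norm_integral_le_of_norm_le hst (Eventually.of_forall fun x _ => ?_)
    (h.integrable.norm.const_mul _).intervalIntegrable
  exact (norm_mul_le _ _).trans (mul_le_mul_of_nonneg_right (h.norm_left_le x) (norm_nonneg _))

theorem norm_right_sub_le (h : IsEvolution F Y Z) {s t : ℝ} (hs : 0 ≤ s) (hst : s ≤ t) :
    ‖Z t - Z s‖ ≤ Real.exp (∫ x, ‖F x‖) * ∫ x in s..t, ‖F x‖ := by
  rw [h.right_sub hs hst, ← intervalIntegral.integral_const_mul, norm_neg]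
  refine intervalIntegral.norm_integral_le_of_norm_le hst (Eventually.of_forall fun x _ => ?_)
    (h.integrable.norm.const_mul _).intervalIntegrable
  rw [mul_comm]
  exact (norm_mul_le _ _).trans (mul_le_mul_of_nonneg_left (h.norm_right_le x) (norm_nonneg _))

variable [CompleteSpace 𝔸]

theorem norm_left_sub_sub_le (h : IsEvolution F Y Z) {s t : ℝ} (hs : 0 ≤ s) (hst : s ≤ t) :
    ‖Y t - Y s - Y s * ∫ x in s..t, F x‖ ≤
      Real.exp (∫ x, ‖F x‖) * (∫ x in s..t, ‖F x‖) ^ 2 := by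
  have hF := h.integrable
  have e : Y t - Y s - Y s * ∫ x in s..t, F x = ∫ x in s..t, (Y x - Y s) * F x := by
    rw [h.left_sub hs hst, ← intervalIntegral_const_mul hF, ← intervalIntegral.integral_sub
      (intervalIntegrable_continuous_mul hF h.continuous_left s t)
      (intervalIntegrable_continuous_mul hF continuous_const s t)]
    simp_rw [sub_mul]
  rw [e, sq, ← mul_assoc, ← intervalIntegral.integral_const_mul]
  refine intervalIntegral.norm_integral_le_of_norm_le hst (Eventually.of_forall fun x hx => ?_)
    (hF.norm.const_mul _).intervalIntegrable
  refine (norm_mul_le _ _).trans (mul_le_mul_of_nonneg_right ?_ (norm_nonneg _))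
  exact (h.norm_left_sub_le hs hx.1.le).trans
    (mul_le_mul_of_nonneg_left (integral_norm_mono hF hx) (Real.exp_pos _).le)

theorem norm_right_sub_add_le (h : IsEvolution F Y Z) {s t : ℝ} (hs : 0 ≤ s) (hst : s ≤ t) :
    ‖Z t - Z s + (∫ x in s..t, F x) * Z s‖ ≤
      Real.exp (∫ x, ‖F x‖) * (∫ x in s..t, ‖F x‖) ^ 2 := by
  have hF := h.integrable
  have e : Z t - Z s + (∫ x in s..t, F x) * Z s = -∫ x in s..t, F x * (Z x - Z s) := by
    rw [h.right_sub hs hst, ← intervalIntegral_mul_const hF, neg_add_eq_sub, ← neg_sub,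
      ← intervalIntegral.integral_sub
      (intervalIntegrable_mul_continuous hF h.continuous_right s t)
      (intervalIntegrable_mul_continuous hF continuous_const s t)]
    simp_rw [mul_sub]
  rw [e, norm_neg, sq, ← mul_assoc, ← intervalIntegral.integral_const_mul]
  refine intervalIntegral.norm_integral_le_of_norm_le hst (Eventually.of_forall fun x hx => ?_)
    (hF.norm.const_mul _).intervalIntegrable
  rw [mul_comm]
  refine (norm_mul_le _ _).trans (mul_le_mul_of_nonneg_left ?_ (norm_nonneg _))
  exact (h.norm_right_sub_le hs hx.1.le).trans
    (mul_le_mul_of_nonneg_left (integral_norm_mono hF hx) (Real.exp_pos _).le)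

theorem norm_transition_sub_le (h : IsEvolution F Y Z) {s t : ℝ} (hs : 0 ≤ s) (hst : s ≤ t) :
    ‖Z s * Y t - (1 + ∫ x in s..t, F x)‖ ≤
      Real.exp (∫ x, ‖F x‖) ^ 2 * (∫ x in s..t, ‖F x‖) ^ 2 := by
  have e : Z s * Y t - (1 + ∫ x in s..t, F x) = Z s * (Y t - Y s - Y s * ∫ x in s..t, F x) := by
    rw [mul_sub, mul_sub, ← mul_assoc, h.right_mul_left s hs, one_mul, sub_sub]
  rw [e, sq (Real.exp _), mul_assoc]
  exact (norm_mul_le _ _).trans (mul_le_mul (h.norm_right_le s) (h.norm_left_sub_sub_le hs hst)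
    (norm_nonneg _) (Real.exp_pos _).le)

theorem norm_inverse_transition_sub_le (h : IsEvolution F Y Z) {s t : ℝ} (hs : 0 ≤ s)
    (hst : s ≤ t) :
    ‖Z t * Y s - (1 + -∫ x in s..t, F x)‖ ≤
      Real.exp (∫ x, ‖F x‖) ^ 2 * (∫ x in s..t, ‖F x‖) ^ 2 := by
  have e : Z t * Y s - (1 + -∫ x in s..t, F x) =
      (Z t - Z s + (∫ x in s..t, F x) * Z s) * Y s := by
    rw [add_mul, sub_mul, mul_assoc _ (Z s) (Y s), h.right_mul_left s hs, mul_one]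
    abel
  rw [e, sq (Real.exp _), mul_assoc, mul_comm]
  exact (norm_mul_le _ _).trans (mul_le_mul (h.norm_right_sub_add_le hs hst) (h.norm_left_le s)
    (norm_nonneg _) (by positivity))

theorem norm_left_sub_mul_exp_le [NormOneClass 𝔸] (h : IsEvolution F Y Z) {s t : ℝ} (hs : 0 ≤ s)
    (hst : s ≤ t) :
    ‖Y t - Y s * NormedSpace.exp (∫ x in s..t, F x)‖ ≤
      2 * Real.exp (∫ x, ‖F x‖) ^ 2 * (∫ x in s..t, ‖F x‖) ^ 2 := by
  have hF := h.integrable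
  set B := Real.exp (∫ x, ‖F x‖) with hB
  set δ := ∫ x in s..t, ‖F x‖ with hδ
  set X := ∫ x in s..t, F x with hX
  have hXδ : ‖X‖ ≤ δ := intervalIntegral.norm_integral_le_integral_norm hst
  have hδB : Real.exp ‖X‖ ≤ B := Real.exp_le_exp.2 (norm_intervalIntegral_le_integral_norm hF s t)
  have hB1 : 1 ≤ B := Real.one_le_exp (integral_nonneg fun _ => norm_nonneg _)
  have e : Y t - Y s * NormedSpace.exp X =
      (Y t - Y s - Y s * X) - Y s * (NormedSpace.exp X - 1 - X) := by noncomm_ring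
  rw [e]
  calc _ ≤ ‖Y t - Y s - Y s * X‖ + ‖Y s‖ * ‖NormedSpace.exp X - 1 - X‖ :=
        (norm_sub_le _ _).trans (add_le_add_right (norm_mul_le _ _) _)
    _ ≤ B * δ ^ 2 + B * (δ ^ 2 * B) := by
        refine add_le_add (h.norm_left_sub_sub_le hs hst) (mul_le_mul (h.norm_left_le s) ?_
          (norm_nonneg _) (Real.exp_pos _).le)
        refine (norm_exp_sub_one_sub_le X).trans (mul_le_mul ?_ hδB (Real.exp_pos _).le
          (sq_nonneg _))
        exact pow_le_pow_left₀ (norm_nonneg _) hXδ 2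
    _ ≤ 2 * B ^ 2 * δ ^ 2 := by nlinarith [mul_nonneg (sq_nonneg δ) (sub_nonneg.2 hB1)]

/-- The ordered exponential products approximate the evolution, with an explicit error. -/
theorem norm_left_sub_expProd_le [NormOneClass 𝔸] (h : IsEvolution F Y Z) {t : ℕ → ℝ} {m : ℕ}
    (h0 : t 0 = 0) (hle : ∀ i < m, t i ≤ t (i + 1)) :
    ‖Y (t m) - expProd (fun t => ∫ x in (0 : ℝ)..t, F x) t m‖ ≤
      2 * Real.exp (∫ x, ‖F x‖) ^ 3 *
        ∑ i ∈ Finset.range m, (∫ x in t i..t (i + 1), ‖F x‖) ^ 2 := by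
  have hF := h.integrable
  set B := Real.exp (∫ x, ‖F x‖) with hB
  have hnn : ∀ k ≤ m, 0 ≤ t k := by
    intro k
    induction k with
    | zero => intro _; rw [h0]
    | succ k ih => intro hk; exact (ih (by omega)).trans (hle k (by omega))
  have key : ∀ k ≤ m, ‖Y (t k) - expProd (fun t => ∫ x in (0 : ℝ)..t, F x) t k‖ ≤
      2 * B ^ 2 * Real.exp (∫ x in (0 : ℝ)..t k, ‖F x‖) *
        ∑ i ∈ Finset.range k, (∫ x in t i..t (i + 1), ‖F x‖) ^ 2 := by
    intro k
    induction k with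
    | zero =>
      intro _
      have := h.left_eq 0 le_rfl
      simp [expProd, h0, this]
    | succ k ih =>
      intro hk
      have hst := hle k (by omega)
      set X := ∫ x in t k..t (k + 1), F x with hX
      set δ := ∫ x in t k..t (k + 1), ‖F x‖ with hδ
      set P := expProd (fun t => ∫ x in (0 : ℝ)..t, F x) t k with hP
      set S := ∑ i ∈ Finset.range k, (∫ x in t i..t (i + 1), ‖F x‖) ^ 2 with hS
      have hS0 : 0 ≤ S := Finset.sum_nonneg fun _ _ => sq_nonneg _
      have hXδ : ‖X‖ ≤ δ := intervalIntegral.norm_integral_le_integral_norm hst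
      have hc : ∫ x in (0 : ℝ)..t (k + 1), ‖F x‖ = (∫ x in (0 : ℝ)..t k, ‖F x‖) + δ := by
        rw [hδ, ← primitive_sub hF.norm (t k)]; ring
      have hc0 : 0 ≤ ∫ x in (0 : ℝ)..t (k + 1), ‖F x‖ :=
        intervalIntegral.integral_nonneg (hnn _ hk) fun _ _ => norm_nonneg _
      have e : Y (t (k + 1)) - expProd (fun t => ∫ x in (0 : ℝ)..t, F x) t (k + 1) =
          (Y (t (k + 1)) - Y (t k) * NormedSpace.exp X) +
            (Y (t k) - P) * NormedSpace.exp X := by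
        rw [expProd_succ, primitive_sub hF]; noncomm_ring
      rw [e, Finset.sum_range_succ, hc, Real.exp_add, ← hS]
      rw [hc] at hc0
      calc _ ≤ 2 * B ^ 2 * δ ^ 2 + 2 * B ^ 2 * Real.exp (∫ x in (0 : ℝ)..t k, ‖F x‖) * S *
            Real.exp δ := by
            refine (norm_add_le _ _).trans (add_le_add
              (h.norm_left_sub_mul_exp_le (hnn k (by omega)) hst) ((norm_mul_le _ _).trans ?_))
            refine mul_le_mul (ih (by omega)) ((norm_exp_le X).trans (Real.exp_le_exp.2 hXδ))
              (norm_nonneg _) (by positivity)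
        _ ≤ _ := by
            have h1 : 1 ≤ Real.exp (∫ x in (0 : ℝ)..t k, ‖F x‖) * Real.exp δ := by
              rw [← Real.exp_add]; exact Real.one_le_exp hc0
            nlinarith [mul_nonneg (mul_nonneg (sq_nonneg B) (sq_nonneg δ)) (sub_nonneg.2 h1)]
  refine (key m le_rfl).trans ?_
  have h1 : Real.exp (∫ x in (0 : ℝ)..t m, ‖F x‖) ≤ B := by
    refine Real.exp_le_exp.2 ((le_abs_self _).trans ?_)
    simpa using norm_intervalIntegral_le_integral_norm hF.norm 0 (t m)
  have hS0 : 0 ≤ ∑ i ∈ Finset.range m, (∫ x in t i..t (i + 1), ‖F x‖) ^ 2 :=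
    Finset.sum_nonneg fun _ _ => sq_nonneg _
  refine mul_le_mul_of_nonneg_right ?_ hS0
  calc 2 * B ^ 2 * Real.exp (∫ x in (0 : ℝ)..t m, ‖F x‖) ≤ 2 * B ^ 2 * B := by gcongr
    _ = 2 * B ^ 3 := by ring

end IsEvolution

end LocalEstimates

section NormBound

/-- A submultiplicative two-parameter family with `g s t ≤ 1 + (p t - p s) + O((c t - c s)²)` is
bounded by `exp (p t - p s)`. -/
theorem le_exp_of_local_bound {g : ℝ → ℝ → ℝ} {p c : ℝ → ℝ} {K : ℝ} (hc : Continuous c)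
    (hm : Monotone c) (hg0 : ∀ s t, 0 ≤ g s t)
    (hmul : ∀ s t u, 0 ≤ s → s ≤ t → t ≤ u → g s u ≤ g s t * g t u)
    (hloc : ∀ s t, 0 ≤ s → s ≤ t → g s t ≤ 1 + (p t - p s) + K * (c t - c s) ^ 2)
    {a b : ℝ} (ha : 0 ≤ a) (hab : a ≤ b) : g a b ≤ Real.exp (p b - p a) := by
  have h1 := (tendsto_sum_sq_uniformPoint hc hm hab).const_mul K
  rw [mul_zero] at h1
  have h2 : Tendsto (fun N : ℕ => Real.exp (p b - p a + K * ∑ i ∈ Finset.range N,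
      (c (uniformPoint a b N (i + 1)) - c (uniformPoint a b N i)) ^ 2)) atTop
      (𝓝 (Real.exp (p b - p a))) := by
    have := (h1.const_add (p b - p a)).rexp
    rwa [add_zero] at this
  refine ge_of_tendsto h2 ?_
  filter_upwards [eventually_ge_atTop 1] with N hN
  have key : ∀ k, g a (uniformPoint a b N k) ≤
      Real.exp (p (uniformPoint a b N k) - p a + K * ∑ i ∈ Finset.range k,
        (c (uniformPoint a b N (i + 1)) - c (uniformPoint a b N i)) ^ 2) := by
    intro k
    induction k with
    | zero =>
      rw [uniformPoint_zero]
      have := hloc a a ha le_rfl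
      simpa using this
    | succ k ih =>
      have h3 := uniformPoint_le_succ hab N k
      have h4 := le_uniformPoint hab N k
      refine (hmul _ _ _ ha h4 h3).trans ?_
      have h5 := (hloc _ _ (ha.trans h4) h3)
      have h6 : g (uniformPoint a b N k) (uniformPoint a b N (k + 1)) ≤
          Real.exp (p (uniformPoint a b N (k + 1)) - p (uniformPoint a b N k) +
            K * (c (uniformPoint a b N (k + 1)) - c (uniformPoint a b N k)) ^ 2) :=
        h5.trans (by
          refine le_trans (le_of_eq ?_) (Real.add_one_le_exp _)
          ring)
      refine (mul_le_mul ih h6 (hg0 _ _) (Real.exp_pos _).le).trans (le_of_eq ?_)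
      rw [← Real.exp_add, Finset.sum_range_succ]
      congr 1
      ring
  have := key N
  rwa [uniformPoint_last a b (by omega)] at this

theorem norm_one_add_le {𝔸 : Type*} [NormedRing 𝔸] [StarRing 𝔸] [CStarRing 𝔸] [NormOneClass 𝔸]
    (x : 𝔸) : ‖1 + x‖ ≤ 1 + ‖x + star x‖ / 2 + ‖x‖ ^ 2 := by
  have h1 : ‖1 + x‖ ^ 2 ≤ 1 + ‖x + star x‖ + ‖x‖ ^ 2 := by
    rw [sq, ← CStarRing.norm_star_mul_self]
    have e : star (1 + x) * (1 + x) = 1 + (x + star x) + star x * x := by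
      rw [star_add, star_one]; noncomm_ring
    rw [e, sq, ← CStarRing.norm_star_mul_self (x := x)]
    refine (norm_add_le _ _).trans (add_le_add_left ((norm_add_le _ _).trans ?_) _)
    rw [norm_one]
  refine abs_le_of_sq_le_sq' ?_ (by positivity) |>.2
  nlinarith [norm_nonneg (x + star x), sq_nonneg ‖x‖, sq_nonneg ‖x + star x‖,
    mul_nonneg (norm_nonneg (x + star x)) (sq_nonneg ‖x‖)]

variable {𝔸 : Type*} [CStarAlgebra 𝔸] [NormOneClass 𝔸] {F Y Z : ℝ → 𝔸}

theorem IsEvolution.norm_transition_le (h : IsEvolution F Y Z) {p : ℝ → ℝ}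
    (hp : ∀ s t, 0 ≤ s → s ≤ t →
      ‖(∫ x in s..t, F x) + star (∫ x in s..t, F x)‖ ≤ 2 * (p t - p s))
    {s t : ℝ} (hs : 0 ≤ s) (hst : s ≤ t) : ‖Z s * Y t‖ ≤ Real.exp (p t - p s) := by
  have hF := h.integrable
  refine le_exp_of_local_bound (g := fun s t => ‖Z s * Y t‖)
    (K := 1 + Real.exp (∫ x, ‖F x‖) ^ 2) (continuous_primitive hF.norm)
    (monotone_primitive hF.norm fun _ => norm_nonneg _) (fun _ _ => norm_nonneg _) ?_ ?_ hs hst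
  · intro s t u hs hst htu
    have e : Z s * Y u = Z s * Y t * (Z t * Y u) := by
      rw [mul_assoc, ← mul_assoc (Y t), h.left_mul_right t (hs.trans hst), one_mul]
    rw [e]
    exact norm_mul_le _ _
  · intro s t hs hst
    have h1 := h.norm_transition_sub_le hs hst
    have h2 := norm_one_add_le (∫ x in s..t, F x)
    have h3 := hp s t hs hst
    have h4 : ‖∫ x in s..t, F x‖ ^ 2 ≤ (∫ x in s..t, ‖F x‖) ^ 2 :=
      pow_le_pow_left₀ (norm_nonneg _) (intervalIntegral.norm_integral_le_integral_norm hst) 2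
    have h5 := norm_le_norm_add_norm_sub' (Z s * Y t) (1 + ∫ x in s..t, F x)
    rw [primitive_sub hF.norm]
    linarith

theorem IsEvolution.norm_inverse_transition_le (h : IsEvolution F Y Z) {p : ℝ → ℝ}
    (hp : ∀ s t, 0 ≤ s → s ≤ t →
      ‖(∫ x in s..t, F x) + star (∫ x in s..t, F x)‖ ≤ 2 * (p t - p s))
    {s t : ℝ} (hs : 0 ≤ s) (hst : s ≤ t) : ‖Z t * Y s‖ ≤ Real.exp (p t - p s) := by
  have hF := h.integrable
  refine le_exp_of_local_bound (g := fun s t => ‖Z t * Y s‖)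
    (K := 1 + Real.exp (∫ x, ‖F x‖) ^ 2) (continuous_primitive hF.norm)
    (monotone_primitive hF.norm fun _ => norm_nonneg _) (fun _ _ => norm_nonneg _) ?_ ?_ hs hst
  · intro s t u hs hst htu
    have e : Z u * Y s = Z u * Y t * (Z t * Y s) := by
      rw [mul_assoc, ← mul_assoc (Y t), h.left_mul_right t (hs.trans hst), one_mul]
    rw [e, mul_comm ‖Z t * Y s‖]
    exact norm_mul_le _ _
  · intro s t hs hst
    have h1 := h.norm_inverse_transition_sub_le hs hst
    have h2 := norm_one_add_le (-∫ x in s..t, F x)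
    have h3 := hp s t hs hst
    have h4 : ‖∫ x in s..t, F x‖ ^ 2 ≤ (∫ x in s..t, ‖F x‖) ^ 2 :=
      pow_le_pow_left₀ (norm_nonneg _) (intervalIntegral.norm_integral_le_integral_norm hst) 2
    have h5 := norm_le_norm_add_norm_sub' (Z t * Y s) (1 + -∫ x in s..t, F x)
    rw [star_neg, ← neg_add, norm_neg, norm_neg] at h2
    rw [primitive_sub hF.norm]
    linarith

end NormBound

section Refinement

/-- Subdivision of every interval of a partition into `k` equal parts. -/
noncomputable def subdividedPoint (t : ℕ → ℝ) (k j : ℕ) : ℝ :=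
  uniformPoint (t (j / k)) (t (j / k + 1)) k (j % k)

theorem subdividedPoint_mul (t : ℕ → ℝ) {k : ℕ} (hk : 0 < k) (i : ℕ) :
    subdividedPoint t k (i * k) = t i := by
  simp [subdividedPoint, Nat.mul_div_cancel _ hk, uniformPoint_zero]

theorem subdividedPoint_succ (t : ℕ → ℝ) {k : ℕ} (hk : 0 < k) (j : ℕ) :
    subdividedPoint t k (j + 1) =
      uniformPoint (t (j / k)) (t (j / k + 1)) k (j % k + 1) := by
  rcases Nat.lt_or_ge (j % k + 1) k with h | h
  · have h1 : (j + 1) / k = j / k := by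
      rw [Nat.succ_div_of_not_dvd]
      intro hd
      have := Nat.mod_eq_zero_of_dvd hd
      rw [Nat.add_mod, Nat.mod_eq_of_lt (show 1 < k by omega), Nat.mod_eq_of_lt h] at this
      omega
    have h2 : (j + 1) % k = j % k + 1 := by
      rw [Nat.add_mod, Nat.mod_eq_of_lt (show 1 < k by omega), Nat.mod_eq_of_lt h]
    rw [subdividedPoint, h1, h2]
  · have h3 : j % k + 1 = k := le_antisymm (Nat.mod_lt _ hk) h
    have h4 : j + 1 = (j / k + 1) * k := by
      have := Nat.div_add_mod' j k
      rw [add_mul]; omega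
    rw [h4, subdividedPoint_mul t hk, h3, uniformPoint_last _ _ (by omega)]

theorem div_lt_of_lt_mul_right {j m k : ℕ} (h : j < m * k) : j / k < m :=
  Nat.div_lt_of_lt_mul (by rwa [mul_comm])

/-- The partition obtained by dividing every interval into `k` equal parts. -/
noncomputable def TaggedPartition.subdivide {a b : ℝ} (τ : TaggedPartition a b) (k : ℕ)
    (hk : 0 < k) : TaggedPartition a b where
  m := τ.m * k
  t := subdividedPoint τ.t k
  ξ := subdividedPoint τ.t k
  t_zero := by
    have := subdividedPoint_mul τ.t hk 0
    rw [zero_mul] at this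
    rw [this, τ.t_zero]
  t_last := by rw [subdividedPoint_mul τ.t hk, τ.t_last]
  t_le i hi := by
    rw [subdividedPoint_succ τ.t hk]
    exact uniformPoint_le_succ (τ.t_le _ (div_lt_of_lt_mul_right hi)) _ _
  ξ_mem i hi := by
    refine ⟨le_rfl, ?_⟩
    rw [subdividedPoint_succ τ.t hk]
    exact uniformPoint_le_succ (τ.t_le _ (div_lt_of_lt_mul_right hi)) _ _

theorem TaggedPartition.points_subset_subdivide {a b : ℝ} (τ : TaggedPartition a b) (k : ℕ)
    (hk : 0 < k) : τ.points ⊆ (τ.subdivide k hk).points := by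
  rintro _ ⟨i, hi, rfl⟩
  exact ⟨i * k, Nat.mul_le_mul_right k hi, subdividedPoint_mul τ.t hk i⟩

theorem TaggedPartition.t_mono {a b : ℝ} (τ : TaggedPartition a b) {i j : ℕ} (hij : i ≤ j)
    (hj : j ≤ τ.m) : τ.t i ≤ τ.t j := by
  induction j, hij using Nat.le_induction with
  | base => exact le_rfl
  | succ j _ ih => exact (ih (by omega)).trans (τ.t_le j (by omega))

theorem TaggedPartition.t_mem {a b : ℝ} (τ : TaggedPartition a b) {i : ℕ} (hi : i ≤ τ.m) :
    τ.t i ∈ Icc a b :=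
  ⟨τ.t_zero.symm.le.trans (τ.t_mono (Nat.zero_le i) hi), (τ.t_mono hi le_rfl).trans τ.t_last.le⟩

theorem TaggedPartition.subdivide_mesh {a b : ℝ} (τ : TaggedPartition a b) (k : ℕ)
    (hk : 0 < k) {i : ℕ} (hi : i < (τ.subdivide k hk).m) :
    (τ.subdivide k hk).t (i + 1) - (τ.subdivide k hk).t i ≤ (b - a) / k := by
  have hq : i / k < τ.m := div_lt_of_lt_mul_right hi
  have h1 := (τ.t_mem hq).2
  have h2 := (τ.t_mem hq.le).1
  change subdividedPoint τ.t k (i + 1) - subdividedPoint τ.t k i ≤ _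
  rw [subdividedPoint_succ τ.t hk, subdividedPoint, uniformPoint_succ_sub]
  gcongr

variable {n : ℕ} {F Y Z : ℝ → Matrix (Fin n) (Fin n) ℂ}

theorem stieltjesProd_eq_expProd {b : ℝ} {E : ℝ → Matrix (Fin n) (Fin n) ℂ}
    (hE : ∀ t ∈ Icc 0 b, E t = ∫ x in (0 : ℝ)..t, F x) (τ : TaggedPartition 0 b) :
    stieltjesProd (fun _ => 1) E τ = expProd (fun t => ∫ x in (0 : ℝ)..t, F x) τ.t τ.m := by
  rw [stieltjesProd, expProd]
  congr 1
  refine List.map_congr_left fun i hi => ?_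
  have hi : i < τ.m := List.mem_range.1 hi
  rw [one_smul, hE _ (τ.t_mem hi), hE _ (τ.t_mem hi.le)]

/-- The multiplicative integral is the final value of the evolution. -/
theorem IsEvolution.eq_of_hasMultStieltjesIntegral [NeZero n] (h : IsEvolution F Y Z) {b : ℝ}
    {E : ℝ → Matrix (Fin n) (Fin n) ℂ} (hE : ∀ t ∈ Icc 0 b, E t = ∫ x in (0 : ℝ)..t, F x)
    {P : Matrix (Fin n) (Fin n) ℂ} (hP : HasMultStieltjesIntegral (fun _ => 1) E 0 b P) :
    P = Y b := by
  have hF := h.integrable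
  set B := 2 * Real.exp (∫ x, ‖F x‖) ^ 3 with hB
  have hBpos : 0 < B := by positivity
  refine eq_of_forall_dist_le fun ε hε => ?_
  obtain ⟨τ₀, hτ₀⟩ := hP (ε / 2) (half_pos hε)
  obtain ⟨η, hη, hsum⟩ := exists_mesh_sum_sq_le (continuous_primitive hF.norm)
    (monotone_primitive hF.norm fun _ => norm_nonneg _) 0 b (ε := ε / (2 * B)) (by positivity)
  have h1 : ∀ᶠ k : ℕ in atTop, (b - 0) / k ≤ η :=
    (tendsto_const_div_atTop_nhds_zero_nat (b - 0)).eventually_le_const hη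
  obtain ⟨k, hk1, hk⟩ := (h1.and (eventually_gt_atTop 0)).exists
  set τ := τ₀.subdivide k hk with hτ
  have h2 := hτ₀ τ (τ₀.points_subset_subdivide k hk)
  have h3 := h.norm_left_sub_expProd_le τ.t_zero τ.t_le
  have h4 := hsum τ.m τ.t τ.t_zero τ.t_last τ.t_le
    (fun i hi => (τ₀.subdivide_mesh k hk hi).trans hk1)
  simp_rw [primitive_sub hF.norm] at h4
  rw [τ.t_last, ← stieltjesProd_eq_expProd hE τ] at h3
  have h5 : ‖Y b - stieltjesProd (fun _ => 1) E τ‖ ≤ ε / 2 := by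
    refine h3.trans ((mul_le_mul_of_nonneg_left h4 hBpos.le).trans (le_of_eq ?_))
    field_simp
  rw [dist_eq_norm, norm_sub_rev]
  calc ‖Y b - P‖ ≤ ‖Y b - stieltjesProd (fun _ => 1) E τ‖ +
        ‖stieltjesProd (fun _ => 1) E τ - P‖ := norm_sub_le_norm_sub_add_norm_sub _ _ _
    _ ≤ ε := by linarith

end Refinement

section Herglotz

theorem one_sub_norm_le (z : ℂ) (φ : ℝ) :
    1 - ‖z‖ ≤ ‖z - Complex.exp (φ * Complex.I)‖ := by
  have := norm_sub_norm_le (Complex.exp (φ * Complex.I)) z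
  rwa [Complex.norm_exp_ofReal_mul_I, norm_sub_rev] at this

theorem sub_exp_ne_zero {z : ℂ} (hz : ‖z‖ < 1) (φ : ℝ) :
    z - Complex.exp (φ * Complex.I) ≠ 0 :=
  norm_pos_iff.1 ((sub_pos.2 hz).trans_le (one_sub_norm_le z φ))

theorem continuous_herglotz {z : ℂ} (hz : ‖z‖ < 1) : Continuous (herglotz z) := by
  unfold herglotz
  exact Continuous.div (by fun_prop) (by fun_prop) (sub_exp_ne_zero hz)

theorem norm_herglotz_le {z : ℂ} {r : ℝ} (hz : ‖z‖ ≤ r) (hr : r < 1) (φ : ℝ) :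
    ‖herglotz z φ‖ ≤ 2 / (1 - r) := by
  rw [herglotz, norm_div]
  have h1 := one_sub_norm_le z φ
  have h2 : ‖z + Complex.exp (φ * Complex.I)‖ ≤ 2 := by
    refine (norm_add_le _ _).trans ?_
    rw [Complex.norm_exp_ofReal_mul_I]; linarith
  exact div_le_div₀ (by norm_num) h2 (by linarith) (by linarith)

theorem re_herglotz {z : ℂ} (φ : ℝ) :
    (herglotz z φ).re = -((1 - ‖z‖ ^ 2) / ‖z - Complex.exp (φ * Complex.I)‖ ^ 2) := by
  have he : Complex.normSq (Complex.exp (φ * Complex.I)) = 1 := by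
    rw [Complex.normSq_eq_norm_sq, Complex.norm_exp_ofReal_mul_I, one_pow]
  rw [herglotz, Complex.div_re, ← Complex.normSq_eq_norm_sq, ← Complex.normSq_eq_norm_sq]
  rw [← add_div, ← neg_div]
  congr 1
  rw [Complex.normSq_apply] at he ⊢
  simp only [Complex.add_re, Complex.sub_re, Complex.add_im, Complex.sub_im]
  linear_combination -he

/-- The Poisson kernel, up to normalization. -/
noncomputable def poisson (z : ℂ) (φ : ℝ) : ℝ := -(herglotz z φ).re

theorem poisson_eq (z : ℂ) (φ : ℝ) :
    poisson z φ = (1 - ‖z‖ ^ 2) / ‖z - Complex.exp (φ * Complex.I)‖ ^ 2 := by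
  rw [poisson, re_herglotz, neg_neg]

theorem poisson_nonneg {z : ℂ} (hz : ‖z‖ < 1) (φ : ℝ) : 0 ≤ poisson z φ := by
  rw [poisson_eq]
  have : ‖z‖ ^ 2 ≤ 1 := pow_le_one₀ (norm_nonneg _) hz.le
  exact div_nonneg (by linarith) (sq_nonneg _)

theorem continuous_poisson {z : ℂ} (hz : ‖z‖ < 1) : Continuous (poisson z) :=
  (Complex.continuous_re.comp (continuous_herglotz hz)).neg

theorem poisson_le {z : ℂ} {r : ℝ} (hz : ‖z‖ ≤ r) (hr : r < 1) (φ : ℝ) :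
    poisson z φ ≤ 2 / (1 - r) :=
  (neg_le_abs _).trans ((Complex.abs_re_le_norm _).trans (norm_herglotz_le hz hr φ))

theorem hasDerivAt_herglotz {z : ℂ} (hz : ‖z‖ < 1) (φ : ℝ) :
    HasDerivAt (fun z => herglotz z φ)
      (-2 * Complex.exp (φ * Complex.I) / (z - Complex.exp (φ * Complex.I)) ^ 2) z := by
  unfold herglotz
  have h1 := ((hasDerivAt_id z).add_const (Complex.exp (φ * Complex.I))).div
    ((hasDerivAt_id z).sub_const (Complex.exp (φ * Complex.I))) (sub_exp_ne_zero hz φ)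
  refine h1.congr_deriv ?_
  congr 1
  simp only [id]
  ring

variable {E : Type*} [NormedAddCommGroup E] [NormedSpace ℂ E]

theorem integrable_herglotz_smul {f : ℝ → E} (hf : Integrable f) {z : ℂ} (hz : ‖z‖ < 1) :
    Integrable fun φ => herglotz z φ • f φ := by
  refine Integrable.mono' (hf.norm.const_mul (2 / (1 - ‖z‖)))
    ((continuous_herglotz hz).aestronglyMeasurable.smul hf.aestronglyMeasurable)
    (Eventually.of_forall fun φ => ?_)
  rw [norm_smul]
  exact mul_le_mul_of_nonneg_right (norm_herglotz_le le_rfl hz φ) (norm_nonneg _)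

theorem integrable_poisson_mul {u : ℝ → ℝ} (hu : Integrable u) {z : ℂ} (hz : ‖z‖ < 1) :
    Integrable fun φ => poisson z φ * u φ := by
  refine hu.bdd_mul (c := 2 / (1 - ‖z‖)) (continuous_poisson hz).aestronglyMeasurable
    (Eventually.of_forall fun φ => ?_)
  rw [Real.norm_eq_abs, abs_of_nonneg (poisson_nonneg hz φ)]
  exact poisson_le le_rfl hz φ

theorem differentiableOn_integral_herglotz {f : ℝ → E} (hf : Integrable f) (s t : ℝ) :
    DifferentiableOn ℂ (fun z => ∫ φ in s..t, herglotz z φ • f φ) (Metric.ball 0 1) := by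
  intro z₀ hz₀
  rw [mem_ball_zero_iff] at hz₀
  obtain ⟨r, hr0, hr1⟩ := exists_between hz₀
  have hs : Metric.ball (0 : ℂ) r ∈ 𝓝 z₀ := Metric.isOpen_ball.mem_nhds (by simpa using hr0)
  have hder : Continuous fun φ : ℝ =>
      -2 * Complex.exp (φ * Complex.I) / (z₀ - Complex.exp (φ * Complex.I)) ^ 2 :=
    Continuous.div (by fun_prop) (by fun_prop) fun φ => pow_ne_zero 2 (sub_exp_ne_zero hz₀ φ)
  have := intervalIntegral.hasDerivAt_integral_of_dominated_loc_of_deriv_le (𝕜 := ℂ)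
    (μ := volume) (a := s) (b := t) (bound := fun φ => 2 / (1 - r) ^ 2 * ‖f φ‖)
    (F := fun z φ => herglotz z φ • f φ)
    (F' := fun z φ => (-2 * Complex.exp (φ * Complex.I) /
      (z - Complex.exp (φ * Complex.I)) ^ 2) • f φ) hs ?_
    (integrable_herglotz_smul hf hz₀).intervalIntegrable ?_ ?_
    (hf.norm.const_mul _).intervalIntegrable ?_
  · exact this.2.differentiableAt.differentiableWithinAt
  · filter_upwards [hs] with z hz
    rw [mem_ball_zero_iff] at hz
    exact (integrable_herglotz_smul hf (hz.trans hr1)).aestronglyMeasurable.restrict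
  · exact (hder.aestronglyMeasurable.smul hf.aestronglyMeasurable).restrict
  · refine Eventually.of_forall fun φ _ z hz => ?_
    rw [mem_ball_zero_iff] at hz
    rw [norm_smul, norm_div, norm_mul, norm_pow, Complex.norm_exp_ofReal_mul_I]
    refine mul_le_mul_of_nonneg_right ?_ (norm_nonneg _)
    have h1 := one_sub_norm_le z φ
    have h2 : 0 < 1 - r := sub_pos.2 hr1
    simp only [norm_neg, Complex.norm_ofNat, mul_one]
    gcongr
    linarith
  · refine Eventually.of_forall fun φ _ z hz => ?_
    rw [mem_ball_zero_iff] at hz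
    exact (hasDerivAt_herglotz (hz.trans hr1) φ).smul_const _

end Herglotz

section Analyticity

variable {𝔸 : Type*} [NormedRing 𝔸] [NormedAlgebra ℂ 𝔸] [CompleteSpace 𝔸]

theorem differentiableOn_expProd {E : ℂ → ℝ → 𝔸} {U : Set ℂ}
    (hE : ∀ t, DifferentiableOn ℂ (fun z => E z t) U) (t : ℕ → ℝ) (m : ℕ) :
    DifferentiableOn ℂ (fun z => expProd (E z) t m) U := by
  induction m with
  | zero => simp [expProd]
  | succ m ih =>
    simp_rw [expProd_succ]
    refine ih.mul ?_
    have hexp : Differentiable ℂ (NormedSpace.exp : 𝔸 → 𝔸) := fun x =>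
      (NormedSpace.exp_analytic (𝕂 := ℂ) x).differentiableAt
    exact hexp.comp_differentiableOn ((hE _).sub (hE _))

variable [NormOneClass 𝔸]

theorem differentiableOn_evolution {M : ℝ → 𝔸} (hM : Integrable M) {Y Z : ℂ → ℝ → 𝔸}
    (h : ∀ z ∈ Metric.ball (0 : ℂ) 1, IsEvolution (fun φ => herglotz z φ • M φ) (Y z) (Z z))
    {t : ℝ} (ht : 0 ≤ t) :
    DifferentiableOn ℂ (fun z => Y z t) (Metric.ball 0 1) := by
  intro z₀ hz₀
  rw [mem_ball_zero_iff] at hz₀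
  obtain ⟨r, hr0, hr1⟩ := exists_between hz₀
  have hsub : Metric.ball (0 : ℂ) r ⊆ Metric.ball 0 1 := Metric.ball_subset_ball hr1.le
  suffices hd : DifferentiableOn ℂ (fun z => Y z t) (Metric.ball 0 r) from
    (hd.differentiableAt (Metric.isOpen_ball.mem_nhds (by simpa using hr0))).differentiableWithinAt
  set κ : ℝ := 2 / (1 - r) with hκ
  have hκ0 : 0 ≤ κ := div_nonneg zero_le_two (sub_nonneg.2 hr1.le)
  set f : ℕ → ℂ → 𝔸 := fun N z =>
    expProd (fun t => ∫ φ in (0 : ℝ)..t, herglotz z φ • M φ) (uniformPoint 0 t N) N with hf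
  set S : ℕ → ℝ := fun N => ∑ i ∈ Finset.range N,
    ((∫ x in (0 : ℝ)..uniformPoint 0 t N (i + 1), ‖M x‖) -
      ∫ x in (0 : ℝ)..uniformPoint 0 t N i, ‖M x‖) ^ 2 with hS
  have hS0 : Tendsto (fun N => 2 * Real.exp (κ * ∫ x, ‖M x‖) ^ 3 * κ ^ 2 * S N) atTop (𝓝 0) := by
    have := (tendsto_sum_sq_uniformPoint (continuous_primitive hM.norm)
      (monotone_primitive hM.norm fun _ => norm_nonneg _) ht).const_mul
        (2 * Real.exp (κ * ∫ x, ‖M x‖) ^ 3 * κ ^ 2)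
    rwa [mul_zero] at this
  have hbound : ∀ N : ℕ, 1 ≤ N → ∀ z ∈ Metric.ball (0 : ℂ) r,
      ‖Y z t - f N z‖ ≤ 2 * Real.exp (κ * ∫ x, ‖M x‖) ^ 3 * κ ^ 2 * S N := by
    intro N hN z hz
    have hz' : ‖z‖ < r := mem_ball_zero_iff.1 hz
    have hev := h z (hsub hz)
    have h1 := hev.norm_left_sub_expProd_le (t := uniformPoint 0 t N) (m := N)
      (uniformPoint_zero _ _ _) (fun i _ => uniformPoint_le_succ ht N i)
    rw [uniformPoint_last _ _ (by omega)] at h1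
    have hn : ∀ x, ‖herglotz z x • M x‖ ≤ κ * ‖M x‖ := fun x => by
      rw [norm_smul]
      exact mul_le_mul_of_nonneg_right (norm_herglotz_le hz'.le hr1 x) (norm_nonneg _)
    have h2 : ∫ x, ‖herglotz z x • M x‖ ≤ κ * ∫ x, ‖M x‖ := by
      rw [← integral_const_mul]
      exact integral_mono hev.integrable.norm (hM.norm.const_mul _) hn
    have h3 : ∑ i ∈ Finset.range N, (∫ x in uniformPoint 0 t N i..uniformPoint 0 t N (i + 1),
        ‖herglotz z x • M x‖) ^ 2 ≤ κ ^ 2 * S N := by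
      rw [hS, Finset.mul_sum]
      refine Finset.sum_le_sum fun i _ => ?_
      have h4 := uniformPoint_le_succ ht N i
      rw [← mul_pow, primitive_sub hM.norm, ← intervalIntegral.integral_const_mul]
      refine pow_le_pow_left₀ (intervalIntegral.integral_nonneg h4 fun _ _ => norm_nonneg _) ?_ 2
      exact intervalIntegral.integral_mono_on h4 hev.integrable.norm.intervalIntegrable
        (hM.norm.const_mul _).intervalIntegrable fun x _ => hn x
    refine h1.trans ?_
    rw [mul_assoc _ (κ ^ 2)]
    refine mul_le_mul ?_ h3 (Finset.sum_nonneg fun _ _ => sq_nonneg _) (by positivity)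
    gcongr
  have hlim : TendstoUniformlyOn f (fun z => Y z t) atTop (Metric.ball 0 r) := by
    rw [Metric.tendstoUniformlyOn_iff]
    intro ε hε
    filter_upwards [hS0.eventually_lt_const hε, eventually_ge_atTop 1] with N hN hN1 z hz
    rw [dist_eq_norm]
    exact (hbound N hN1 z hz).trans_lt hN
  refine hlim.tendstoLocallyUniformlyOn.differentiableOn (Eventually.of_forall fun N => ?_)
    Metric.isOpen_ball
  exact differentiableOn_expProd
    (fun t => (differentiableOn_integral_herglotz hM 0 t).mono hsub) _ _

theorem differentiableOn_evolution_inverse {M : ℝ → 𝔸} (hM : Integrable M) {Y Z : ℂ → ℝ → 𝔸}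
    (h : ∀ z ∈ Metric.ball (0 : ℂ) 1, IsEvolution (fun φ => herglotz z φ • M φ) (Y z) (Z z))
    {t : ℝ} (ht : 0 ≤ t) :
    DifferentiableOn ℂ (fun z => Z z t) (Metric.ball 0 1) := by
  have hu : ∀ z ∈ Metric.ball (0 : ℂ) 1, ∃ u : 𝔸ˣ, (u : 𝔸) = Y z t ∧ ((u⁻¹ : 𝔸ˣ) : 𝔸) = Z z t :=
    fun z hz => ⟨⟨Y z t, Z z t, (h z hz).left_mul_right t ht, (h z hz).right_mul_left t ht⟩,
      rfl, rfl⟩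
  refine ((differentiableOn_evolution hM h ht).inverse fun z hz => ?_).congr fun z hz => ?_
  · obtain ⟨u, hu, -⟩ := hu z hz
    exact hu ▸ u.isUnit
  · obtain ⟨u, hu, hu'⟩ := hu z hz
    rw [← hu, ← hu', Ring.inverse_unit]

end Analyticity

section MaximumPrinciple

/-- Disjoint closed arcs of the circle are uniformly separated: every point keeps a fixed distance
from one of them. -/
theorem exists_pos_arc_separation {a b c d : ℝ} (ha : 0 < a) (hbc : b < c)
    (hd : d < 2 * Real.pi) :
    ∃ ρ > 0, ∀ z : ℂ, (∀ φ ∈ Icc a b, ρ ≤ ‖z - Complex.exp (φ * Complex.I)‖) ∨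
      ∀ φ ∈ Icc c d, ρ ≤ ‖z - Complex.exp (φ * Complex.I)‖ := by
  set e : ℝ → ℂ := fun φ => Complex.exp (φ * Complex.I) with he
  have hec : Continuous e := by fun_prop
  have hdisj : Disjoint (e '' Icc a b) (e '' Icc c d) := by
    rw [Set.disjoint_left]
    rintro _ ⟨φ, hφ, rfl⟩ ⟨ψ, hψ, h⟩
    obtain ⟨k, hk⟩ := Complex.exp_eq_exp_iff_exists_int.1 h
    have hk' : ψ = φ + k * (2 * Real.pi) := by
      have h1 : ((ψ : ℂ)) * Complex.I = ((φ + k * (2 * Real.pi) : ℝ) : ℂ) * Complex.I := by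
        rw [hk]; push_cast; ring
      exact_mod_cast mul_right_cancel₀ Complex.I_ne_zero h1
    have hpi := Real.pi_pos
    have h2 : (0 : ℝ) < k := by
      by_contra hneg
      have : (k : ℝ) * (2 * Real.pi) ≤ 0 :=
        mul_nonpos_of_nonpos_of_nonneg (not_lt.1 hneg) (by positivity)
      linarith [hφ.2, hψ.1]
    have h3 : (k : ℝ) < 1 := by
      by_contra hneg
      have : 2 * Real.pi ≤ (k : ℝ) * (2 * Real.pi) :=
        le_mul_of_one_le_left (by positivity) (not_lt.1 hneg)
      linarith [hφ.1, hψ.2]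
    have h4 : (0 : ℤ) < k := by exact_mod_cast h2
    have h5 : k < (1 : ℤ) := by exact_mod_cast h3
    omega
  obtain ⟨r, hr, hsep⟩ := Metric.exists_pos_forall_lt_edist (isCompact_Icc.image hec)
    (isCompact_Icc.image hec).isClosed hdisj
  refine ⟨r / 2, by positivity, fun z => ?_⟩
  by_contra hcon
  rw [not_or] at hcon
  push Not at hcon
  obtain ⟨⟨φ, hφ, h1⟩, ψ, hψ, h2⟩ := hcon
  have h3 := hsep (e φ) (mem_image_of_mem e hφ) (e ψ) (mem_image_of_mem e hψ)
  rw [edist_nndist] at h3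
  have h4 : (r : ℝ) < dist (e φ) (e ψ) := by exact_mod_cast h3
  have h5 : dist (e φ) (e ψ) ≤ dist z (e φ) + dist z (e ψ) := dist_triangle_left _ _ _
  rw [dist_eq_norm z, dist_eq_norm z] at h5
  simp only [he] at h4 h5
  linarith

theorem integral_poisson_mul_le {u : ℝ → ℝ} (hu : Integrable u) (hu0 : ∀ φ, 0 ≤ u φ)
    {a b ρ : ℝ} (hab : a ≤ b) (hρ : 0 < ρ) {z : ℂ} (hz : ‖z‖ < 1)
    (h : ∀ φ ∈ Icc a b, ρ ≤ ‖z - Complex.exp (φ * Complex.I)‖) :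
    ∫ φ in a..b, poisson z φ * u φ ≤ (1 - ‖z‖ ^ 2) / ρ ^ 2 * ∫ φ, ‖u φ‖ := by
  have h1 : (0 : ℝ) ≤ 1 - ‖z‖ ^ 2 := by
    have : ‖z‖ ^ 2 ≤ 1 := pow_le_one₀ (norm_nonneg _) hz.le
    linarith
  calc ∫ φ in a..b, poisson z φ * u φ
      ≤ ∫ φ in a..b, (1 - ‖z‖ ^ 2) / ρ ^ 2 * u φ := by
        refine intervalIntegral.integral_mono_on hab
          (integrable_poisson_mul hu hz).intervalIntegrable
          (hu.const_mul _).intervalIntegrable fun φ hφ => ?_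
        refine mul_le_mul_of_nonneg_right ?_ (hu0 φ)
        rw [poisson_eq]
        have := h φ hφ
        gcongr
    _ ≤ _ := by
        rw [intervalIntegral.integral_const_mul]
        exact mul_le_mul_of_nonneg_left ((le_abs_self _).trans
          (norm_intervalIntegral_le_integral_norm hu a b)) (by positivity)

/-- The integral of `f` over the `δ`-neighbourhood of `{0, t, 2π}` in `[0, 2π]`. -/
noncomputable def cutIntegral {E : Type*} [NormedAddCommGroup E] [NormedSpace ℝ E] (t δ : ℝ)
    (f : ℝ → E) : E :=
  (∫ φ in (0 : ℝ)..δ, f φ) + (∫ φ in (t - δ)..(t + δ), f φ) +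
    ∫ φ in (2 * Real.pi - δ)..(2 * Real.pi), f φ

theorem tendsto_cutIntegral {E : Type*} [NormedAddCommGroup E] [NormedSpace ℝ E] {f : ℝ → E}
    (hf : Integrable f) (t : ℝ) : Tendsto (fun δ => cutIntegral t δ f) (𝓝[>] 0) (𝓝 0) := by
  have hc : Continuous fun δ => cutIntegral t δ f := by
    have hp := continuous_primitive hf
    simp only [cutIntegral, ← primitive_sub hf (t - _), ← primitive_sub hf (2 * Real.pi - _)]
    exact ((hp.add ((hp.comp (continuous_const.add continuous_id)).sub
      (hp.comp (continuous_const.sub continuous_id)))).add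
      (continuous_const.sub (hp.comp (continuous_const.sub continuous_id))))
  have h0 : cutIntegral t 0 f = 0 := by simp [cutIntegral]
  have := hc.tendsto 0
  rw [h0] at this
  exact this.mono_left nhdsWithin_le_nhds

theorem re_cutIntegral_herglotz {u : ℝ → ℝ} (hu : Integrable u) (t δ : ℝ) {z : ℂ}
    (hz : ‖z‖ < 1) :
    (cutIntegral t δ fun φ => herglotz z φ • (u φ : ℂ)).re =
      -cutIntegral t δ fun φ => poisson z φ * u φ := by
  have hi : Integrable fun φ => herglotz z φ • (u φ : ℂ) :=
    integrable_herglotz_smul (hu.ofReal (𝕜 := ℂ)) hz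
  have key : ∀ a b : ℝ, (∫ φ in a..b, herglotz z φ • (u φ : ℂ)).re =
      -∫ φ in a..b, poisson z φ * u φ := fun a b => by
    have h1 := Complex.reCLM.intervalIntegral_comp_comm (μ := volume) (a := a) (b := b)
      hi.intervalIntegrable
    rw [← Complex.reCLM_apply, ← h1, ← intervalIntegral.integral_neg]
    refine intervalIntegral.integral_congr fun φ _ => ?_
    simp [poisson]
  simp only [cutIntegral, Complex.add_re, key]
  ring

variable {E : Type*} [NormedAddCommGroup E] [NormedSpace ℂ E]

theorem norm_le_exp_cutIntegral {g : ℂ → E} (hg : DifferentiableOn ℂ g (Metric.ball 0 1))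
    {u : ℝ → ℝ} (hu : Integrable u) (hu0 : ∀ φ, 0 ≤ u φ) {t δ : ℝ} (hδ : 0 < δ)
    (hδt : 2 * δ ≤ t) (htδ : t + 2 * δ ≤ 2 * Real.pi)
    (h₁ : ∀ z ∈ Metric.ball (0 : ℂ) 1,
      ‖g z‖ ≤ Real.exp (∫ φ in (0 : ℝ)..t, poisson z φ * u φ))
    (h₂ : ∀ z ∈ Metric.ball (0 : ℂ) 1,
      ‖g z‖ ≤ Real.exp (∫ φ in t..(2 * Real.pi), poisson z φ * u φ))
    {z : ℂ} (hz : ‖z‖ < 1) :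
    ‖g z‖ ≤ Real.exp (cutIntegral t δ fun φ => poisson z φ * u φ) := by
  obtain ⟨ρ, hρ, hsep⟩ := exists_pos_arc_separation (a := δ) (b := t - δ) (c := t + δ)
    (d := 2 * Real.pi - δ) hδ (by linarith) (by linarith)
  set H : ℂ → ℂ := fun z => cutIntegral t δ fun φ => herglotz z φ • (u φ : ℂ) with hH
  have hHd : DifferentiableOn ℂ H (Metric.ball 0 1) :=
    ((differentiableOn_integral_herglotz hu.ofReal _ _).add
      (differentiableOn_integral_herglotz hu.ofReal _ _)).add
      (differentiableOn_integral_herglotz hu.ofReal _ _)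
  have hf : DifferentiableOn ℂ (fun z => Complex.exp (H z) • g z) (Metric.ball 0 1) :=
    hHd.cexp.smul hg
  set η : ℝ → ℝ := fun r => (1 - r ^ 2) / ρ ^ 2 * ∫ φ, ‖u φ‖ with hη
  have hnorm : ∀ z : ℂ, ‖z‖ < 1 → ‖Complex.exp (H z) • g z‖ =
      Real.exp (-cutIntegral t δ fun φ => poisson z φ * u φ) * ‖g z‖ := fun z hz => by
    rw [norm_smul, Complex.norm_exp, hH, re_cutIntegral_herglotz hu t δ hz]
  have hbd : ∀ z : ℂ, ‖z‖ < 1 → ‖g z‖ ≤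
      Real.exp ((cutIntegral t δ fun φ => poisson z φ * u φ) + η ‖z‖) := by
    intro z hz
    have hi := integrable_poisson_mul hu hz
    have hzb : z ∈ Metric.ball (0 : ℂ) 1 := mem_ball_zero_iff.2 hz
    have hpos : ∀ a b : ℝ, a ≤ b → 0 ≤ ∫ φ in a..b, poisson z φ * u φ := fun a b hab =>
      intervalIntegral.integral_nonneg hab fun φ _ => mul_nonneg (poisson_nonneg hz φ) (hu0 φ)
    have hadd : ∀ a b c : ℝ, (∫ φ in a..b, poisson z φ * u φ) + ∫ φ in b..c, poisson z φ * u φ =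
        ∫ φ in a..c, poisson z φ * u φ := fun a b c =>
      intervalIntegral.integral_add_adjacent_intervals hi.intervalIntegrable hi.intervalIntegrable
    have a1 := hadd 0 δ (t - δ)
    have a2 := hadd 0 (t - δ) t
    have a3 := hadd (t - δ) t (t + δ)
    have a4 := hadd t (t + δ) (2 * Real.pi - δ)
    have a5 := hadd t (2 * Real.pi - δ) (2 * Real.pi)
    have p1 := hpos t (t + δ) (by linarith)
    have p2 := hpos (t - δ) t (by linarith)
    have p3 := hpos 0 δ hδ.le
    have p4 := hpos (2 * Real.pi - δ) (2 * Real.pi) (by linarith)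
    rcases hsep z with h | h
    · have h3 := integral_poisson_mul_le hu hu0 (by linarith) hρ hz h
      refine (h₁ z hzb).trans (Real.exp_le_exp.2 ?_)
      simp only [cutIntegral, hη]
      linarith
    · have h3 := integral_poisson_mul_le hu hu0 (by linarith) hρ hz h
      refine (h₂ z hzb).trans (Real.exp_le_exp.2 ?_)
      simp only [cutIntegral, hη]
      linarith
  have hmax : ∀ r : ℝ, ‖z‖ < r → r < 1 → ‖Complex.exp (H z) • g z‖ ≤ Real.exp (η r) := by
    intro r hzr hr
    have hr0 : r ≠ 0 := ((norm_nonneg z).trans_lt hzr).ne'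
    have hsub : Metric.closedBall (0 : ℂ) r ⊆ Metric.ball 0 1 :=
      Metric.closedBall_subset_ball hr
    refine Complex.norm_le_of_forall_mem_frontier_norm_le (U := Metric.ball (0 : ℂ) r)
      (f := fun z => Complex.exp (H z) • g z) Metric.isBounded_ball ?_ ?_ ?_
    · refine DifferentiableOn.diffContOnCl ?_
      rw [closure_ball _ hr0]
      exact hf.mono hsub
    · intro w hw
      rw [frontier_ball _ hr0, mem_sphere_zero_iff_norm] at hw
      have hw1 : ‖w‖ < 1 := hw ▸ hr
      rw [hnorm w hw1, ← hw]
      refine (mul_le_mul_of_nonneg_left (hbd w hw1) (Real.exp_pos _).le).trans (le_of_eq ?_)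
      rw [← Real.exp_add, neg_add_cancel_left]
    · exact subset_closure (mem_ball_zero_iff.2 hzr)
  have hlim : Tendsto (fun r => Real.exp (η r)) (𝓝[<] 1) (𝓝 1) := by
    have hc : Continuous fun r => Real.exp (η r) := by simp only [hη]; fun_prop
    have h0 : Real.exp (η 1) = 1 := by simp [hη]
    have := hc.tendsto 1
    rw [h0] at this
    exact this.mono_left nhdsWithin_le_nhds
  have hle : ‖Complex.exp (H z) • g z‖ ≤ 1 := by
    refine ge_of_tendsto hlim ?_
    filter_upwards [Ioo_mem_nhdsLT hz] with r hr
    exact hmax r hr.1 hr.2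
  rw [hnorm z hz, Real.exp_neg, inv_mul_le_iff₀ (Real.exp_pos _), mul_one] at hle
  exact hle

/-- An analytic function on the disk which is dominated by the exponentials of two Poisson
integrals over complementary arcs is bounded by `1`. -/
theorem norm_le_one_of_le_exp_poisson {g : ℂ → E}
    (hg : DifferentiableOn ℂ g (Metric.ball 0 1))
    {u : ℝ → ℝ} (hu : Integrable u) (hu0 : ∀ φ, 0 ≤ u φ) {t : ℝ} (ht : t ∈ Icc 0 (2 * Real.pi))
    (h₁ : ∀ z ∈ Metric.ball (0 : ℂ) 1,
      ‖g z‖ ≤ Real.exp (∫ φ in (0 : ℝ)..t, poisson z φ * u φ))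
    (h₂ : ∀ z ∈ Metric.ball (0 : ℂ) 1,
      ‖g z‖ ≤ Real.exp (∫ φ in t..(2 * Real.pi), poisson z φ * u φ))
    {z : ℂ} (hz : z ∈ Metric.ball (0 : ℂ) 1) : ‖g z‖ ≤ 1 := by
  rcases eq_or_lt_of_le ht.1 with h0 | h0
  · simpa [← h0] using h₁ z hz
  rcases eq_or_lt_of_le ht.2 with h2 | h2
  · simpa [h2] using h₂ z hz
  have hz' : ‖z‖ < 1 := mem_ball_zero_iff.1 hz
  have hlim := (tendsto_cutIntegral (integrable_poisson_mul hu hz') t).rexp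
  rw [Real.exp_zero] at hlim
  refine ge_of_tendsto hlim ?_
  have hpos : 0 < min (t / 2) ((2 * Real.pi - t) / 2) :=
    lt_min (by linarith) (by linarith)
  filter_upwards [Ioo_mem_nhdsGT hpos] with δ hδ
  have h3 := hδ.2.trans_le (min_le_left _ _)
  have h4 := hδ.2.trans_le (min_le_right _ _)
  exact norm_le_exp_cutIntegral hg hu hu0 hδ.1 (by linarith) (by linarith) h₁ h₂ hz'

end MaximumPrinciple

section Uniqueness

theorem ae_eq_zero_of_primitive_eq_zero {E : Type*} [NormedAddCommGroup E] [NormedSpace ℝ E]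
    [CompleteSpace E] {f : ℝ → E} (hf : Integrable f) {a b : ℝ} (hab : a ≤ b)
    (h : ∀ t ∈ Icc a b, ∫ x in a..t, f x = 0) : ∀ᵐ x ∂(volume.restrict (Icc a b)), f x = 0 := by
  rw [← restrict_Ioo_eq_restrict_Icc, ae_restrict_iff' measurableSet_Ioo]
  filter_upwards [(hf.intervalIntegrable (a := a) (b := b)).ae_hasDerivAt_integral] with x hx hxab
  rw [uIcc_of_le hab] at hx
  have h1 := hx (Ioo_subset_Icc_self hxab) a (left_mem_Icc.2 hab)
  have h2 : (fun x => ∫ t in a..x, f t) =ᶠ[𝓝 x] fun _ => 0 := by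
    filter_upwards [Ioo_mem_nhds hxab.1 hxab.2] with y hy
    exact h y (Ioo_subset_Icc_self hy)
  exact h1.unique ((hasDerivAt_const x (0 : E)).congr_of_eventuallyEq h2)

/-- For almost everywhere self-adjoint `M`, the real part of `∫ h_z M` is controlled by the Poisson
integral of `‖M‖`. -/
theorem norm_integral_herglotz_add_star_le {𝔸 : Type*} [CStarAlgebra 𝔸] {M : ℝ → 𝔸}
    (hM : Integrable M) (hsa : ∀ᵐ φ, star (M φ) = M φ) {z : ℂ} (hz : ‖z‖ < 1) {s t : ℝ}
    (hst : s ≤ t) :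
    ‖(∫ φ in s..t, herglotz z φ • M φ) + star (∫ φ in s..t, herglotz z φ • M φ)‖ ≤
      2 * ((∫ φ in (0 : ℝ)..t, poisson z φ * ‖M φ‖) - ∫ φ in (0 : ℝ)..s, poisson z φ * ‖M φ‖) := by
  have hi := integrable_herglotz_smul hM hz
  have hp := integrable_poisson_mul hM.norm hz
  have hstar : star (∫ φ in s..t, herglotz z φ • M φ) =
      ∫ φ in s..t, star (herglotz z φ • M φ) :=
    ((starL' ℝ : 𝔸 ≃L[ℝ] 𝔸).toContinuousLinearMap.intervalIntegral_comp_comm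
      hi.intervalIntegrable).symm
  have hi' : Integrable fun φ => star (herglotz z φ • M φ) :=
    (starL' ℝ : 𝔸 ≃L[ℝ] 𝔸).toContinuousLinearMap.integrable_comp hi
  rw [hstar, ← intervalIntegral.integral_add hi.intervalIntegrable hi'.intervalIntegrable,
    primitive_sub hp, ← intervalIntegral.integral_const_mul]
  refine intervalIntegral.norm_integral_le_of_norm_le hst ?_ (hp.const_mul 2).intervalIntegrable
  filter_upwards [hsa] with φ hφ _
  rw [star_smul, hφ, ← add_smul, norm_smul, ← mul_assoc]
  refine mul_le_mul_of_nonneg_right (le_of_eq ?_) (norm_nonneg _)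
  rw [Complex.star_def, Complex.add_conj, Complex.norm_real, Real.norm_eq_abs, abs_mul, abs_two,
    ← abs_of_nonneg (poisson_nonneg hz φ), poisson, abs_neg]

variable {n : ℕ}

/-- Analytic families of isometric matrices are constant. -/
theorem eq_of_norm_le_one_of_mul_eq_one {G G' : ℂ → Matrix (Fin n) (Fin n) ℂ}
    (hd : DifferentiableOn ℂ G (Metric.ball 0 1))
    (hG : ∀ z ∈ Metric.ball (0 : ℂ) 1, ‖G z‖ ≤ 1) (hG' : ∀ z ∈ Metric.ball (0 : ℂ) 1, ‖G' z‖ ≤ 1)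
    (h : ∀ z ∈ Metric.ball (0 : ℂ) 1, G' z * G z = 1) {z : ℂ} (hz : z ∈ Metric.ball (0 : ℂ) 1) :
    G z = G 0 := by
  set T := Matrix.toEuclideanCLM (n := Fin n) (𝕜 := ℂ) with hT
  have hTn : ∀ A : Matrix (Fin n) (Fin n) ℂ, ‖A‖ ≤ 1 → ∀ x, ‖T A x‖ ≤ ‖x‖ := fun A hA x => by
    refine ((T A).le_opNorm x).trans ?_
    have : ‖T A‖ ≤ 1 := by rwa [hT, ← Matrix.cstar_norm_def]
    exact mul_le_of_le_one_left (norm_nonneg _) this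
  have hiso : ∀ z ∈ Metric.ball (0 : ℂ) 1, ∀ x, ‖T (G z) x‖ = ‖x‖ := fun z hz x => by
    refine le_antisymm (hTn _ (hG z hz) x) ?_
    have h1 : T (G' z) (T (G z) x) = x := by
      rw [← mul_apply_eq_comp, ← map_mul, h z hz, map_one]; rfl
    calc ‖x‖ = ‖T (G' z) (T (G z) x)‖ := by rw [h1]
      _ ≤ _ := hTn _ (hG' z hz) _
  apply T.injective
  ext1 x
  have hdx : DifferentiableOn ℂ (fun z => T (G z) x) (Metric.ball 0 1) := by
    have hl : Differentiable ℂ fun A : Matrix (Fin n) (Fin n) ℂ => T A x := by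
      let l : Matrix (Fin n) (Fin n) ℂ →ₗ[ℂ] EuclideanSpace ℂ (Fin n) :=
        { toFun := fun A => T A x
          map_add' := fun A B => by simp
          map_smul' := fun c A => by simp }
      exact l.toContinuousLinearMap.differentiable
    exact hl.comp_differentiableOn hd
  have h0 : (0 : ℂ) ∈ Metric.ball (0 : ℂ) 1 := by simp
  have := Complex.eqOn_of_isPreconnected_of_isMaxOn_norm
    (convex_ball (0 : ℂ) 1).isPreconnected Metric.isOpen_ball hdx h0
    (fun w hw => by simp only [mem_ofPred_eq, Function.comp_apply, hiso w hw, hiso 0 h0, le_refl])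
  exact this hz

theorem IsEvolution.left_zero {𝔸 : Type*} [NormedRing 𝔸] [NormedAlgebra ℂ 𝔸] {F Y Z : ℝ → 𝔸}
    (h : IsEvolution F Y Z) : Y 0 = 1 := by
  simpa using h.left_eq 0 le_rfl

theorem IsEvolution.right_zero {𝔸 : Type*} [NormedRing 𝔸] [NormedAlgebra ℂ 𝔸] {F Y Z : ℝ → 𝔸}
    (h : IsEvolution F Y Z) : Z 0 = 1 := by
  simpa using h.right_eq 0 le_rfl

variable [NeZero n] {M₁ M₂ : ℝ → Matrix (Fin n) (Fin n) ℂ}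
  {Y₁ Z₁ Y₂ Z₂ : ℂ → ℝ → Matrix (Fin n) (Fin n) ℂ} {V : Matrix (Fin n) (Fin n) ℂ}

/-- If two evolutions have the same total transition, up to a constant contraction, then the
connecting matrices are contractions. -/
theorem norm_connecting_le_one (hM₁ : Integrable M₁) (hM₂ : Integrable M₂)
    (hs₁ : ∀ᵐ φ, star (M₁ φ) = M₁ φ) (hs₂ : ∀ᵐ φ, star (M₂ φ) = M₂ φ)
    (h₁ : ∀ z ∈ Metric.ball (0 : ℂ) 1,
      IsEvolution (fun φ => herglotz z φ • M₁ φ) (Y₁ z) (Z₁ z))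
    (h₂ : ∀ z ∈ Metric.ball (0 : ℂ) 1,
      IsEvolution (fun φ => herglotz z φ • M₂ φ) (Y₂ z) (Z₂ z))
    (hV : ‖V‖ ≤ 1)
    (hVY : ∀ z ∈ Metric.ball (0 : ℂ) 1, V * Y₁ z (2 * Real.pi) = Y₂ z (2 * Real.pi))
    {t : ℝ} (ht : t ∈ Icc 0 (2 * Real.pi)) {z : ℂ} (hz : z ∈ Metric.ball (0 : ℂ) 1) :
    ‖Z₂ z t * V * Y₁ z t‖ ≤ 1 := by
  have hpi : (0 : ℝ) ≤ 2 * Real.pi := ht.1.trans ht.2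
  have hu : Integrable fun φ => ‖M₁ φ‖ + ‖M₂ φ‖ := hM₁.norm.add hM₂.norm
  have hint : ∀ z ∈ Metric.ball (0 : ℂ) 1, ∀ a b : ℝ,
      ∫ φ in a..b, poisson z φ * (‖M₁ φ‖ + ‖M₂ φ‖) =
        (∫ φ in a..b, poisson z φ * ‖M₁ φ‖) + ∫ φ in a..b, poisson z φ * ‖M₂ φ‖ := by
    intro z hz a b
    have hz := mem_ball_zero_iff.1 hz
    simp_rw [mul_add]
    exact intervalIntegral.integral_add (integrable_poisson_mul hM₁.norm hz).intervalIntegrable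
      (integrable_poisson_mul hM₂.norm hz).intervalIntegrable
  refine norm_le_one_of_le_exp_poisson (g := fun z => Z₂ z t * V * Y₁ z t) ?_ hu
    (fun φ => by positivity) ht ?_ ?_ hz
  · exact ((differentiableOn_evolution_inverse hM₂ h₂ ht.1).mul_const V).mul
      (differentiableOn_evolution hM₁ h₁ ht.1)
  · intro z hz
    have hz' := mem_ball_zero_iff.1 hz
    have b1 := (h₁ z hz).norm_transition_le
      (fun s t _ hst => norm_integral_herglotz_add_star_le hM₁ hs₁ hz' hst) le_rfl ht.1
    have b2 := (h₂ z hz).norm_inverse_transition_le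
      (fun s t _ hst => norm_integral_herglotz_add_star_le hM₂ hs₂ hz' hst) le_rfl ht.1
    rw [(h₁ z hz).right_zero, one_mul, primitive_sub (integrable_poisson_mul hM₁.norm hz')] at b1
    rw [(h₂ z hz).left_zero, mul_one, primitive_sub (integrable_poisson_mul hM₂.norm hz')] at b2
    rw [hint z hz, add_comm, Real.exp_add]
    refine (norm_mul_le _ _).trans (mul_le_mul ?_ b1 (norm_nonneg _) (Real.exp_pos _).le)
    exact (norm_mul_le _ _).trans ((mul_le_of_le_one_right (norm_nonneg _) hV).trans b2)
  · intro z hz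
    have hz' := mem_ball_zero_iff.1 hz
    have b1 := (h₁ z hz).norm_inverse_transition_le
      (fun s t _ hst => norm_integral_herglotz_add_star_le hM₁ hs₁ hz' hst) ht.1 ht.2
    have b2 := (h₂ z hz).norm_transition_le
      (fun s t _ hst => norm_integral_herglotz_add_star_le hM₂ hs₂ hz' hst) ht.1 ht.2
    rw [primitive_sub (integrable_poisson_mul hM₁.norm hz')] at b1
    rw [primitive_sub (integrable_poisson_mul hM₂.norm hz')] at b2
    have e : Z₂ z t * V * Y₁ z t =
        (Z₂ z t * Y₂ z (2 * Real.pi)) * (Z₁ z (2 * Real.pi) * Y₁ z t) := by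
      rw [← hVY z hz]
      have := (h₁ z hz).left_mul_right _ hpi
      calc _ = Z₂ z t * V * (Y₁ z (2 * Real.pi) * Z₁ z (2 * Real.pi)) * Y₁ z t := by
            rw [this, mul_one]
        _ = _ := by noncomm_ring
    rw [e, hint z hz, add_comm, Real.exp_add]
    exact (norm_mul_le _ _).trans (mul_le_mul b2 b1 (norm_nonneg _) (Real.exp_pos _).le)

/-- The coefficient of an evolution driven by the Herglotz kernel is determined by its total
transition, even up to a constant unitary factor. -/
theorem ae_eq_of_unitary_mul_evolution_eq (hM₁ : Integrable M₁) (hM₂ : Integrable M₂)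
    (hs₁ : ∀ᵐ φ, star (M₁ φ) = M₁ φ) (hs₂ : ∀ᵐ φ, star (M₂ φ) = M₂ φ)
    (h₁ : ∀ z ∈ Metric.ball (0 : ℂ) 1,
      IsEvolution (fun φ => herglotz z φ • M₁ φ) (Y₁ z) (Z₁ z))
    (h₂ : ∀ z ∈ Metric.ball (0 : ℂ) 1,
      IsEvolution (fun φ => herglotz z φ • M₂ φ) (Y₂ z) (Z₂ z))
    (hV : V ∈ unitary (Matrix (Fin n) (Fin n) ℂ))
    (hVY : ∀ z ∈ Metric.ball (0 : ℂ) 1, V * Y₁ z (2 * Real.pi) = Y₂ z (2 * Real.pi)) :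
    ∀ᵐ φ ∂(volume.restrict (Icc 0 (2 * Real.pi))), M₁ φ = M₂ φ := by
  have hpi : (0 : ℝ) ≤ 2 * Real.pi := by positivity
  have hVn : ‖V‖ ≤ 1 := (CStarRing.norm_of_mem_unitary hV).le
  have hVn' : ‖star V‖ ≤ 1 := by rwa [norm_star]
  have hVs : star V * V = 1 := Unitary.star_mul_self_of_mem hV
  have hVY' : ∀ z ∈ Metric.ball (0 : ℂ) 1,
      star V * Y₂ z (2 * Real.pi) = Y₁ z (2 * Real.pi) := fun z hz => by
    rw [← hVY z hz, ← mul_assoc, hVs, one_mul]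
  set U : ℝ → Matrix (Fin n) (Fin n) ℂ := fun t => Z₂ 0 t * V * Y₁ 0 t with hU
  have hconst : ∀ z ∈ Metric.ball (0 : ℂ) 1, ∀ t ∈ Icc 0 (2 * Real.pi),
      Z₂ z t * V * Y₁ z t = U t := by
    intro z hz t ht
    refine eq_of_norm_le_one_of_mul_eq_one (G := fun z => Z₂ z t * V * Y₁ z t)
      (G' := fun z => Z₁ z t * star V * Y₂ z t) ?_ ?_ ?_ ?_ hz
    · exact ((differentiableOn_evolution_inverse hM₂ h₂ ht.1).mul_const V).mul
        (differentiableOn_evolution hM₁ h₁ ht.1)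
    · exact fun z hz => norm_connecting_le_one hM₁ hM₂ hs₁ hs₂ h₁ h₂ hVn hVY ht hz
    · exact fun z hz => norm_connecting_le_one hM₂ hM₁ hs₂ hs₁ h₂ h₁ hVn' hVY' ht hz
    · intro z hz
      calc _ = Z₁ z t * star V * (Y₂ z t * Z₂ z t) * V * Y₁ z t := by noncomm_ring
        _ = Z₁ z t * (star V * V) * Y₁ z t := by
          rw [(h₂ z hz).left_mul_right t ht.1, mul_one, mul_assoc (Z₁ z t)]
        _ = 1 := by rw [hVs, mul_one, (h₁ z hz).right_mul_left t ht.1]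
  have h0 : (0 : ℂ) ∈ Metric.ball (0 : ℂ) 1 := by simp
  have hUc : Continuous U :=
    ((h₂ 0 h0).continuous_right.mul continuous_const).mul (h₁ 0 h0).continuous_left
  obtain ⟨K, hK⟩ : ∃ K, ∀ t, ‖U t‖ ≤ K := by
    refine ⟨Real.exp (∫ s, ‖herglotz 0 s • M₂ s‖) * ‖V‖ *
      Real.exp (∫ s, ‖herglotz 0 s • M₁ s‖), fun t => ?_⟩
    refine (norm_mul_le _ _).trans (mul_le_mul ((norm_mul_le _ _).trans ?_)
      ((h₁ 0 h0).norm_left_le t) (norm_nonneg _) (by positivity))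
    exact mul_le_mul_of_nonneg_right ((h₂ 0 h0).norm_right_le t) (norm_nonneg _)
  set R : ℝ → Matrix (Fin n) (Fin n) ℂ := fun s => U s * M₁ s - M₂ s * U s with hR
  have hRi : Integrable R :=
    (integrable_continuous_mul hM₁ hUc hK).sub (integrable_mul_continuous hM₂ hUc hK)
  have hUint : ∀ z ∈ Metric.ball (0 : ℂ) 1, ∀ t ∈ Icc 0 (2 * Real.pi),
      U t = V + ∫ s in (0 : ℝ)..t, herglotz z s • R s := by
    intro z hz t ht
    have e₁ := h₁ z hz
    have e₂ := h₂ z hz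
    have i₁ := integrable_continuous_mul e₁.integrable e₁.continuous_left e₁.norm_left_le
    have i₂ := integrable_mul_continuous e₂.integrable e₂.continuous_right e₂.norm_right_le
    have key := mul_eq_add_integral (f := fun s => V * (Y₁ z s * (herglotz z s • M₁ s)))
      (g := fun s => -((herglotz z s • M₂ s) * Z₂ z s)) (X := Z₂ z) (Y := fun s => V * Y₁ z s)
      (i₁.const_mul V) i₂.neg e₂.continuous_right (continuous_const.mul e₁.continuous_left)
      (x₀ := 1) (y₀ := V) e₂.right_eq
      (fun t ht => by rw [intervalIntegral_const_mul i₁, e₁.left_eq t ht, mul_add, mul_one]) ht.1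
    rw [one_mul, ← mul_assoc, hconst z hz t ht] at key
    rw [key]
    congr 1
    refine intervalIntegral.integral_congr fun s hs => ?_
    rw [uIcc_of_le ht.1] at hs
    have hs' := hconst z hz s ⟨hs.1, hs.2.trans ht.2⟩
    simp only [hR]
    rw [← hs']
    simp only [smul_sub, neg_mul, smul_mul_assoc, mul_smul_comm, mul_assoc]
    abel
  have hhalf : (1 / 2 : ℂ) ∈ Metric.ball (0 : ℂ) 1 := by
    rw [mem_ball_zero_iff]; norm_num
  have hhalf' : ‖(1 / 2 : ℂ)‖ < 1 := mem_ball_zero_iff.1 hhalf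
  have hzero : ∀ s, herglotz 0 s = -1 := fun s => by
    simp [herglotz]
  have hRae : ∀ᵐ s ∂(volume.restrict (Icc 0 (2 * Real.pi))), R s = 0 := by
    have hd := ae_eq_zero_of_primitive_eq_zero
      ((integrable_herglotz_smul hRi hhalf').sub
        (integrable_herglotz_smul hRi (mem_ball_zero_iff.1 h0))) hpi (fun t ht => by
        have a1 := hUint _ hhalf t ht
        have a2 := hUint _ h0 t ht
        simp only [Pi.sub_apply]
        rw [intervalIntegral.integral_sub
          (integrable_herglotz_smul hRi hhalf').intervalIntegrable
          (integrable_herglotz_smul hRi (mem_ball_zero_iff.1 h0)).intervalIntegrable, sub_eq_zero]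
        exact add_left_cancel (a1.symm.trans a2))
    filter_upwards [hd] with s hs
    simp only [Pi.sub_apply] at hs
    rw [← sub_smul, hzero] at hs
    refine (smul_eq_zero.1 hs).resolve_left fun hc => ?_
    have hne := sub_exp_ne_zero hhalf' s
    rw [herglotz, sub_neg_eq_add, div_add_one hne, div_eq_zero_iff] at hc
    rcases hc with hc | hc
    · ring_nf at hc
      norm_num at hc
    · exact hne hc
  have hUV : ∀ t ∈ Icc 0 (2 * Real.pi), U t = V := fun t ht => by
    rw [hUint 0 h0 t ht]
    have : ∫ s in (0 : ℝ)..t, herglotz 0 s • R s = 0 := by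
      refine intervalIntegral.integral_zero_ae ?_
      filter_upwards [(ae_restrict_iff' measurableSet_Icc).1 hRae] with s hs hst
      rw [uIoc_of_le ht.1] at hst
      rw [hs ⟨hst.1.le, hst.2.trans ht.2⟩, smul_zero]
    rw [this, add_zero]
  have hV1 : V = 1 := by
    rw [← hUV _ (right_mem_Icc.2 hpi), hU]
    simp only
    rw [mul_assoc, hVY 0 h0, (h₂ 0 h0).right_mul_left _ hpi]
  filter_upwards [hRae, ae_restrict_mem measurableSet_Icc] with s hs hs'
  simp only [hR] at hs
  rw [hUV s hs', hV1, one_mul, mul_one, sub_eq_zero] at hs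
  exact hs

end Uniqueness

section Representation

variable {n : ℕ} {M M₁ M₂ : ℝ → Matrix (Fin n) (Fin n) ℂ}

theorem IsIntegrableHermitian.integrable_indicator (h : IsIntegrableHermitian M) :
    Integrable ((Icc 0 (2 * Real.pi)).indicator M) :=
  (integrable_indicator_iff measurableSet_Icc).2 h.integrable

theorem IsIntegrableHermitian.star_indicator (h : IsIntegrableHermitian M) :
    ∀ᵐ φ, star ((Icc 0 (2 * Real.pi)).indicator M φ) = (Icc 0 (2 * Real.pi)).indicator M φ := by
  filter_upwards [(ae_restrict_iff' measurableSet_Icc).1 h.hermitian] with φ hφ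
  by_cases hmem : φ ∈ Icc 0 (2 * Real.pi)
  · rw [indicator_of_mem hmem]
    exact hφ hmem
  · rw [indicator_of_notMem hmem, star_zero]

theorem exists_evolution_family [NeZero n] (h : IsIntegrableHermitian M) :
    ∃ Y Z : ℂ → ℝ → Matrix (Fin n) (Fin n) ℂ, ∀ z ∈ Metric.ball (0 : ℂ) 1,
      IsEvolution (fun φ => herglotz z φ • (Icc 0 (2 * Real.pi)).indicator M φ) (Y z) (Z z) := by
  have : ∀ z : ℂ, ∃ Y Z, z ∈ Metric.ball (0 : ℂ) 1 →
      IsEvolution (fun φ => herglotz z φ • (Icc 0 (2 * Real.pi)).indicator M φ) Y Z := fun z => by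
    by_cases hz : z ∈ Metric.ball (0 : ℂ) 1
    · obtain ⟨Y, Z, hYZ⟩ := exists_isEvolution
        (integrable_herglotz_smul h.integrable_indicator (mem_ball_zero_iff.1 hz))
      exact ⟨Y, Z, fun _ => hYZ⟩
    · exact ⟨0, 0, fun h => absurd h hz⟩
  choose Y Z hYZ using this
  exact ⟨Y, Z, hYZ⟩

theorem HasMultLebesgueIntegral.eq_evolution [NeZero n] {z : ℂ}
    {P : Matrix (Fin n) (Fin n) ℂ} {Y Z : ℝ → Matrix (Fin n) (Fin n) ℂ}
    (hP : HasMultLebesgueIntegral (fun φ => herglotz z φ • M φ) 0 (2 * Real.pi) P)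
    (h : IsEvolution (fun φ => herglotz z φ • (Icc 0 (2 * Real.pi)).indicator M φ) Y Z) :
    P = Y (2 * Real.pi) := by
  refine h.eq_of_hasMultStieltjesIntegral (fun t ht => ?_) hP.2
  refine intervalIntegral.integral_congr fun s hs => ?_
  rw [uIcc_of_le ht.1] at hs
  rw [indicator_of_mem (show s ∈ Icc 0 (2 * Real.pi) from ⟨hs.1, hs.2.trans ht.2⟩)]

/-- A Hermitian density is determined by its multiplicative integral against the Herglotz kernel,
even up to a constant unitary factor. -/
theorem ae_eq_of_unitary_mul_multiplicative_integral_eq (h₁ : IsIntegrableHermitian M₁)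
    (h₂ : IsIntegrableHermitian M₂) {V : Matrix (Fin n) (Fin n) ℂ}
    (hV : V ∈ Matrix.unitaryGroup (Fin n) ℂ)
    (h : ∀ z ∈ Metric.ball (0 : ℂ) 1, ∃ P₁ P₂ : Matrix (Fin n) (Fin n) ℂ,
      HasMultLebesgueIntegral (fun φ => herglotz z φ • M₁ φ) 0 (2 * Real.pi) P₁ ∧
      HasMultLebesgueIntegral (fun φ => herglotz z φ • M₂ φ) 0 (2 * Real.pi) P₂ ∧
      V * P₁ = P₂) :
    ∀ᵐ φ ∂(volume.restrict (Icc 0 (2 * Real.pi))), M₁ φ = M₂ φ := by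
  rcases Nat.eq_zero_or_pos n with rfl | hn
  · exact Eventually.of_forall fun φ => Subsingleton.elim _ _
  have : NeZero n := ⟨hn.ne'⟩
  obtain ⟨Y₁, Z₁, e₁⟩ := exists_evolution_family h₁
  obtain ⟨Y₂, Z₂, e₂⟩ := exists_evolution_family h₂
  have key := ae_eq_of_unitary_mul_evolution_eq h₁.integrable_indicator h₂.integrable_indicator
    h₁.star_indicator h₂.star_indicator e₁ e₂ hV fun z hz => by
      obtain ⟨P₁, P₂, hP₁, hP₂, hVP⟩ := h z hz
      rw [← hP₁.eq_evolution (e₁ z hz), ← hP₂.eq_evolution (e₂ z hz), hVP]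
  filter_upwards [key, ae_restrict_mem measurableSet_Icc] with φ hφ hmem
  rwa [indicator_of_mem hmem, indicator_of_mem hmem] at hφ

end Representation

end MultInt

end

theorem mainTheorem4 (n : ℕ) :
    (∀ (A₁ A₂ : ℂ → Matrix (Fin n) (Fin n) ℂ) (M₁ M₂ : ℝ → Matrix (Fin n) (Fin n) ℂ),
      MultInt.IsHInfty A₁ → MultInt.IsHInfty A₂ →
      MultInt.IsIntegrableHermitian M₁ → MultInt.IsIntegrableHermitian M₂ →
      (∀ z ∈ Metric.ball (0 : ℂ) 1, MultInt.HasMultLebesgueIntegral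
        (fun φ => MultInt.herglotz z φ • M₁ φ) 0 (2 * Real.pi) (A₁ z)) →
      (∀ z ∈ Metric.ball (0 : ℂ) 1, MultInt.HasMultLebesgueIntegral
        (fun φ => MultInt.herglotz z φ • M₂ φ) 0 (2 * Real.pi) (A₂ z)) →
      (∀ z ∈ Metric.ball (0 : ℂ) 1, A₁ z = A₂ z) →
      ∀ᵐ φ ∂(MeasureTheory.volume.restrict (Set.Icc 0 (2 * Real.pi))), M₁ φ = M₂ φ) ∧
    (∀ (A : ℂ → Matrix (Fin n) (Fin n) ℂ) (U₁ U₂ : Matrix (Fin n) (Fin n) ℂ)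
      (M₁ M₂ : ℝ → Matrix (Fin n) (Fin n) ℂ),
      MultInt.IsOuterRepresentation A U₁ M₁ → MultInt.IsOuterRepresentation A U₂ M₂ →
      ∀ᵐ φ ∂(MeasureTheory.volume.restrict (Set.Icc 0 (2 * Real.pi))), M₁ φ = M₂ φ) := by
  refine ⟨fun A₁ A₂ M₁ M₂ _ _ h₁ h₂ hA₁ hA₂ hA => ?_, fun A U₁ U₂ M₁ M₂ h₁ h₂ => ?_⟩
  · exact MultInt.ae_eq_of_unitary_mul_multiplicative_integral_eq h₁ h₂ (one_mem _)
      fun z hz => ⟨A₁ z, A₂ z, hA₁ z hz, hA₂ z hz, by rw [one_mul, hA z hz]⟩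
  · refine MultInt.ae_eq_of_unitary_mul_multiplicative_integral_eq h₁.integrableHermitian
      h₂.integrableHermitian (V := star U₂ * U₁)
      (mul_mem (Unitary.star_mem h₂.unitary) h₁.unitary) fun z hz => ?_
    obtain ⟨P₁, hP₁, hA₁⟩ := h₁.eq_integral z hz
    obtain ⟨P₂, hP₂, hA₂⟩ := h₂.eq_integral z hz
    refine ⟨P₁, P₂, hP₁, hP₂, ?_⟩
    rw [mul_assoc, ← hA₁, hA₂, ← mul_assoc, Unitary.star_mul_self_of_mem h₂.unitary, one_mul]
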